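/- Let $(A,\mathfrak m)$ be a Noetherian local ring with infinite residue field and let $J$ be an $\mathfrak m$-primary ideal of $A$. *Filtrations.* A filtration $\mathcal F=\{I_n\}_{n\ge 0}$ of ideals of a commutative ring $A$ is a chain of ideals with $I_0=A$, $I_1\ne A$, $I_{n+1}\subseteq I_n$ and $I_nI_m\subseteq I_{n+m}$ for all $n,m\ge 0$. For an ideal $I$, $\mathcal F$ is $I$-good if $II_n\subseteq I_{n+1}$ for all $n\ge 0$, with equality for all large $n$; then $I$ is called a reduction of $\mathcal F$. A reduction is minimal if it contains no other reduction properly. $\mathcal F$ is good if it is $I$-good for some ideal $I$, and a good filtration is nilpotent if $I_n=0$ for all large $n$. For an ideal $I$ put $\mathcal F/I=\{I_n(A/I)\}_{n\ge 0}$. *Fiber cones.* Let $R(\mathcal F)=\bigoplus_{n\ge 0}I_nt^n$, let $\mathfrak M=\mathfrak m\oplus\bigoplus_{n>0}I_nt^n$ be its maximal homogeneous ideal, $F_J(\mathcal F)=R(\mathcal F)/JR(\mathcal F)=\bigoplus_{n\ge 0}(I_n/JI_n)t^n$ and $F_J(\mathcal F)^+=\bigoplus_{n>0}(I_n/JI_n)t^n$.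 The analytic spread is $\ell(\mathcal F)=\dim F_{\mathfrak m}(\mathcal F)$. For an ideal $\mathfrak q$ of a ring $R$ of finite dimension $d$ with all $R/\mathfrak q^n$ of finite length, $e(\mathfrak q;R)=\lim_{n\to\infty} d!\,\ell_R(R/\mathfrak q^n)/n^d$; $e(F_J(\mathcal F))$ denotes the Hilbert–Samuel multiplicity of the local ring $F_J(\mathcal F)_{\mathfrak M}$, i.e. the multiplicity of its maximal ideal. For $x\in I_1$, $F_J(\mathcal F/(x))$ means the fiber cone of $\mathcal F/(x)$ with respect to $J(A/(x))$. *Weak-(FC)-sequences.* Let $I$ be an ideal and $\mathcal F$ a non-nilpotent good filtration. An element $x\in I_1$ is a weak-(FC)-element with respect to $(I,\mathcal F)$ if (FC$_1$) there is $N$ such that $I^mI_n\cap(x)=I^mxI_{n-1}$ for all $n\ge N$ and all $m\ge 0$, and (FC$_2$) $0:x\subseteq 0:I_1^\infty=\bigcup_n(0:I_1^n)$. For a good filtration $\mathcal F$ and elements $x_1,\dots,x_s\in I_1$ put $A_i=A/(x_1,\dots,x_i)$ and $\mathcal F_i=\mathcal F/(x_1,\dots,x_i)$. The sequence is a weak-(FC)-sequence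 in $I_1$ with respect to $(I,\mathcal F)$ if for each $0\le i<s$ the image of $x_{i+1}$ in $A_i$ is a weak-(FC)-element with respect to $(IA_i,\mathcal F_i)$ (in particular $\mathcal F_i$ is non-nilpotent). It is maximal if moreover $\mathcal F_s$ is nilpotent while, if $s>0$, $\mathcal F_{s-1}$ is not; the empty sequence is maximal exactly when $\mathcal F$ is nilpotent. **Proposition 2.4.** Let $\mathcal F=\{I_n\}_{n\ge 0}$ be a good filtration of ideals of $A$. Then $\ell=\ell(\mathcal F)$ is a finite non-negative integer, and: (i) If $\ell>0$, then the multiplicities below are defined, all $I_n/JI_n$ have finite length, and $$e(F_J(\mathcal F))=e(F_J(\mathcal F)^+;F_J(\mathcal F))=\lim_{n\to\infty}\frac{(\ell-1)!\;\ell_A(I_n/JI_n)}{n^{\ell-1}}.$$ (ii) If $\ell>1$ and $x\in I_1$ is a weak-(FC)-element with respect to $(J,\mathcal F)$, then $e(F_J(\mathcal F/(x)))=e(F_J(\mathcal F))$ (both being defined). (iii) Maximal weak-(FC)-sequences in $I_1$ with respect to $(J,\mathcal F)$ exist, and each of them has length $\ell$. (iv) If $x_1,\dots,x_\ell$ is a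 weak-(FC)-sequence in $I_1$ with respect to $(J,\mathcal F)$, then $(x_1,\dots,x_\ell)$ is a minimal reduction of $\mathcal F$. (v) Every minimal reduction of $\mathcal F$ is generated by a maximal weak-(FC)-sequence in $I_1$ with respect to $(J,\mathcal F)$. -/

import Mathlib

open Filter Topology Polynomial
open scoped Nat

universe u

/-- `HasMultiplicity q e`: the ring `R` has finite Krull dimension `d`, all the `R`-modules
`R / q ^ n` have finite length, and the Hilbert-Samuel multiplicity
`e(q; R) = lim d! * length (R / q ^ n) / n ^ d` exists and equals `e`. -/
def HasMultiplicity {R : Type u} [CommRing R] (q : Ideal R) (e : ℝ) : Prop :=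
  ∃ d : ℕ, ringKrullDim R = d ∧
    (∀ n : ℕ, Module.length R (R ⧸ q ^ n) ≠ ⊤) ∧
    Tendsto (fun n : ℕ =>
      ((d ! : ℕ) : ℝ) * ((Module.length R (R ⧸ q ^ n)).toNat : ℝ) / (n : ℝ) ^ d) atTop (𝓝 e)

/-- `R` is a local ring, and its Hilbert-Samuel multiplicity (the multiplicity of its maximal
ideal) is `e`. -/
def HasLocalMultiplicity (R : Type u) [CommRing R] (e : ℝ) : Prop :=
  ∃ _ : IsLocalRing R, HasMultiplicity (IsLocalRing.maximalIdeal R) e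

/-- A descending multiplicative chain of ideals `A = I_0 ⊇ I_1 ⊇ ⋯`. That `I_1` is proper is not
a field (so that the image of a filtration in every quotient of `A` is again of this type), but it
is part of the definition of a good filtration, `IdealFiltration.IsGood`. -/
structure IdealFiltration (A : Type u) [CommRing A] where
  /-- the ideals `I_n` -/
  I : ℕ → Ideal A
  I_zero : I 0 = ⊤
  I_succ_le : ∀ n, I (n + 1) ≤ I n
  I_mul_le : ∀ n m, I n * I m ≤ I (n + m)

namespace IdealFiltration

variable {A : Type u} [CommRing A]

/-- `F` is `K`-good: `K I_n ⊆ I_{n+1}` for all `n`, with equality for all large `n`. -/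
def IsGoodFor (F : IdealFiltration A) (K : Ideal A) : Prop :=
  (∀ n, K * F.I n ≤ F.I (n + 1)) ∧ ∀ᶠ n in atTop, F.I (n + 1) = K * F.I n

/-- A good filtration: `I_1` is proper, and the filtration is `K`-good for some ideal `K`. -/
def IsGood (F : IdealFiltration A) : Prop :=
  F.I 1 ≠ ⊤ ∧ ∃ K : Ideal A, F.IsGoodFor K

/-- `I_n = 0` for all large `n`. -/
def IsNilpotent (F : IdealFiltration A) : Prop :=
  ∀ᶠ n in atTop, F.I n = ⊥

/-- `K` is a reduction of `F`. -/
def IsReduction (F : IdealFiltration A) (K : Ideal A) : Prop :=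
  F.IsGoodFor K

/-- A minimal reduction: a reduction not properly containing any other reduction. -/
def IsMinimalReduction (F : IdealFiltration A) (K : Ideal A) : Prop :=
  F.IsReduction K ∧ ∀ L : Ideal A, F.IsReduction L → L ≤ K → L = K

/-- The filtration `F / N` of `A / N`, consisting of the ideals `I_n (A / N)`. -/
def quotient (F : IdealFiltration A) (N : Ideal A) : IdealFiltration (A ⧸ N) where
  I n := (F.I n).map (Ideal.Quotient.mk N)
  I_zero := by rw [F.I_zero, Ideal.map_top]
  I_succ_le n := Ideal.map_mono (F.I_succ_le n)
  I_mul_le n m := by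
    rw [← Ideal.map_mul]
    exact Ideal.map_mono (F.I_mul_le n m)

/-! ### The Rees algebra and the fiber cone -/

/-- The Rees algebra `R(F) = ⨁ I_n t^n`, as a subalgebra of `A[t]`. -/
def rees (F : IdealFiltration A) : Subalgebra A A[X] where
  carrier := {p | ∀ n, p.coeff n ∈ F.I n}
  mul_mem' := by
    intro p q hp hq n
    rw [Polynomial.coeff_mul]
    refine Ideal.sum_mem _ fun c hc => ?_
    rw [← Finset.HasAntidiagonal.mem_antidiagonal.mp hc]
    exact F.I_mul_le _ _ (Ideal.mul_mem_mul (hp c.1) (hq c.2))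
  add_mem' := by
    intro p q hp hq n
    rw [Polynomial.coeff_add]
    exact Ideal.add_mem _ (hp n) (hq n)
  algebraMap_mem' := by
    intro r n
    rw [Polynomial.algebraMap_apply, Algebra.algebraMap_self, RingHom.id_apply,
      Polynomial.coeff_C]
    split_ifs with h
    · rw [h, F.I_zero]; trivial
    · exact Ideal.zero_mem _

/-- The projection of `R(F)` onto its component `I_0 = A` of degree `0`. -/
noncomputable def reesProj (F : IdealFiltration A) : F.rees →+* A :=
  (Polynomial.constantCoeff (R := A)).comp F.rees.val.toRingHom

/-- The fiber cone `F_J(F) = R(F) / J R(F) = ⨁ (I_n / J I_n) t^n`. -/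
def fiberCone (F : IdealFiltration A) (J : Ideal A) : Type u :=
  F.rees ⧸ J.map (algebraMap A F.rees)

noncomputable instance fiberCone_commRing (F : IdealFiltration A) (J : Ideal A) :
    CommRing (F.fiberCone J) :=
  inferInstanceAs (CommRing (F.rees ⧸ J.map (algebraMap A F.rees)))

/-- The canonical surjection of `R(F)` onto `F_J(F)`. -/
noncomputable def fiberMk (F : IdealFiltration A) (J : Ideal A) : F.rees →+* F.fiberCone J :=
  Ideal.Quotient.mk (J.map (algebraMap A F.rees))

/-- The ideal `F_J(F)^+ = ⨁_{n > 0} (I_n / J I_n) t^n` of the fiber cone. -/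
noncomputable def fiberPos (F : IdealFiltration A) (J : Ideal A) : Ideal (F.fiberCone J) :=
  (RingHom.ker F.reesProj).map (F.fiberMk J)

/-- The maximal homogeneous ideal `𝔐 = 𝔪 ⊕ ⨁_{n > 0} I_n t^n` of the Rees algebra. -/
noncomputable def reesMax [IsLocalRing A] (F : IdealFiltration A) : Ideal F.rees :=
  (IsLocalRing.maximalIdeal A).comap F.reesProj

instance reesMax_isPrime [IsLocalRing A] (F : IdealFiltration A) : F.reesMax.IsPrime :=
  Ideal.comap_isPrime _ _

/-- The localization `F_J(F)_𝔐` of the fiber cone at the maximal homogeneous ideal `𝔐` of the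
Rees algebra. -/
abbrev fiberConeLoc [IsLocalRing A] (F : IdealFiltration A) (J : Ideal A) : Type u :=
  Localization (F.reesMax.primeCompl.map (F.fiberMk J))

/-- `A` is a local ring, and `e(F_J(F)) = e`, that is, the Hilbert-Samuel multiplicity of the local
ring `F_J(F)_𝔐` is `e`. -/
def HasFiberMultiplicity (F : IdealFiltration A) (J : Ideal A) (e : ℝ) : Prop :=
  ∃ _ : IsLocalRing A, HasLocalMultiplicity (F.fiberConeLoc J) e

/-- The analytic spread `ℓ(F) = dim F_𝔪(F)`. -/
noncomputable def analyticSpread [IsLocalRing A] (F : IdealFiltration A) : WithBot ℕ∞ :=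
  ringKrullDim (F.fiberCone (IsLocalRing.maximalIdeal A))

/-- The length of the `A`-module `I_n / J I_n`. -/
noncomputable def fiberLength (F : IdealFiltration A) (J : Ideal A) (n : ℕ) : ℕ∞ :=
  Module.length A (F.I n ⧸ (J • ⊤ : Submodule A (F.I n)))

/-! ### Weak-(FC)-elements and weak-(FC)-sequences -/

/-- `x` is filter-regular with respect to `K`: `0 : x ⊆ 0 : K^∞ = ⋃ n, (0 : K ^ n)`. -/
def IsFilterRegular (K : Ideal A) (x : A) : Prop :=
  ∀ a : A, a * x = 0 → ∃ n : ℕ, ∀ b ∈ K ^ n, a * b = 0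

/-- `x` is a weak-(FC)-element with respect to `(K, F)`. The third condition says that
`K^m I_n ∩ (x) = K^m x I_{n-1}` for all large `n` and all `m ≥ 0` (the bound on `n` does not depend
on `m`); the index `n` is shifted by one. -/
def IsWeakFCElement (F : IdealFiltration A) (K : Ideal A) (x : A) : Prop :=
  (F.IsGood ∧ ¬ F.IsNilpotent) ∧
    x ∈ F.I 1 ∧
    (∀ᶠ n in atTop, ∀ m : ℕ,
      K ^ m * F.I (n + 1) ⊓ Ideal.span {x} = K ^ m * (Ideal.span {x} * F.I n)) ∧
    IsFilterRegular (F.I 1) x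

/-- For a list `xs = [x_1, …, x_s]`, the ideal `(x_1, …, x_i)`. -/
abbrev initIdeal (xs : List A) (i : ℕ) : Ideal A :=
  Ideal.ofList (xs.take i)

/-- `xs = [x_1, …, x_s]` is a weak-(FC)-sequence in `I_1` with respect to `(K, F)`: for each
`i < s`, the image of `x_{i+1}` in `A_i = A / (x_1, …, x_i)` is a weak-(FC)-element with respect to
`(K A_i, F / (x_1, …, x_i))`. (Lists are indexed from `0`.) -/
def IsWeakFCSequence (F : IdealFiltration A) (K : Ideal A) (xs : List A) : Prop :=
  (∀ x ∈ xs, x ∈ F.I 1) ∧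
    ∀ (i : ℕ) (hi : i < xs.length),
      (F.quotient (initIdeal xs i)).IsWeakFCElement
        (K.map (Ideal.Quotient.mk (initIdeal xs i)))
        (Ideal.Quotient.mk (initIdeal xs i) xs[i])

/-- A maximal weak-(FC)-sequence `x_1, …, x_s`: the filtration `F / (x_1, …, x_s)` is nilpotent,
but `F / (x_1, …, x_{s-1})` is not (a void condition if `s = 0`: the empty sequence is maximal if
and only if `F` is nilpotent). -/
def IsMaximalWeakFCSequence (F : IdealFiltration A) (K : Ideal A) (xs : List A) : Prop :=
  F.IsWeakFCSequence K xs ∧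
    (∀ i : ℕ, i + 1 = xs.length → ¬ (F.quotient (initIdeal xs i)).IsNilpotent) ∧
    (F.quotient (initIdeal xs xs.length)).IsNilpotent

end IdealFiltration

/-!
The argument is an induction along residue filtrations `F / (x)` for weak-(FC)-elements `x`. All
four numbers to be compared (the length of a maximal weak-(FC)-sequence, the dimension of the fiber
cone, the order of growth of its Hilbert function `n ↦ ℓ_A(I_n / J I_n)`, and the leading
coefficient of the latter) behave in a controlled way when `F` is replaced by `F / (x)`.

*Existence.* If `F` is not nilpotent and `K` is a reduction, then an element `x` of `K` in general
position avoids (up to primes containing `K t`) the associated primes of three graded modules over a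
Rees algebra of the extension of `F` to `A[Js]`; here the infinite residue field is used. Together
with the lemma of Artin and Rees this makes `x` a weak-(FC)-element
(`IsGoodFor.exists_isWeakFCElement`). As the ideals `(x_1, …, x_i)` increase strictly, every
weak-(FC)-sequence in `K` extends to a maximal one in `K`
(`IsWeakFCSequence.exists_isMaximalWeakFCSequence`).

*Length.* Let `x_1, …, x_s` be a maximal weak-(FC)-sequence. It generates a reduction
(`FCChain.isReduction`), so that the fiber cone is finite over a polynomial ring in `s` variables
over an Artinian ring and has dimension at most `s` (`IsGoodFor.ringKrullDim_fiberCone_le`). On the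
other hand, a weak-(FC)-element `x` gives an element `x t` of the fiber cone outside all minimal
primes (`IsWeakFCElement.notMem_minimalPrimes`), so each step lowers the height of the maximal
homogeneous ideal by at least one (`IsWeakFCElement.height_fiberMax_add_one_le`), and that height is
at least `s`. Hence `s` is the dimension of the fiber cone; this depends only on the radical of `J`,
so `s = ℓ(F)` (`FCChain.analyticSpread`). A reduction properly contained in one with `ℓ(F)`
generators would contain one with fewer generators, contrary to the bound on the dimension
(`IsReduction.isMinimalReduction`).

*Multiplicity.* In large degrees the Hilbert function of `F / (x)` is the difference function of
that of `F` (`IsWeakFCElement.eventually_fiberLength_add`), so the normalized leading coefficient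
exists and is the same for both (`IsWeakFCElement.tendsto_fiberLength`,
`FCChain.exists_tendsto_fiberLength`). Finally, up to a shift, the lengths of the residue class
rings of the fiber cone modulo the powers of its irrelevant ideal, as well as of its maximal
homogeneous ideal, are the partial sums of the Hilbert function (`IsGoodFor.exists_length_bounds`),
so both multiplicities are equal to that coefficient (`FCChain.hasMultiplicity`).
-/

/-! ### Good filtrations -/

namespace IdealFiltration

variable {A B : Type u} [CommRing A] [CommRing B]

/-- The image of a filtration under a ring homomorphism; `F.quotient N` is the case of the
projection onto `A ⧸ N`. -/
def map (F : IdealFiltration A) (f : A →+* B) : IdealFiltration B where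
  I n := (F.I n).map f
  I_zero := by rw [F.I_zero, Ideal.map_top]
  I_succ_le n := Ideal.map_mono (F.I_succ_le n)
  I_mul_le n m := by
    rw [← Ideal.map_mul]
    exact Ideal.map_mono (F.I_mul_le n m)

lemma map_I (F : IdealFiltration A) (f : A →+* B) (n : ℕ) : (F.map f).I n = (F.I n).map f := rfl

lemma quotient_I (F : IdealFiltration A) (N : Ideal A) (n : ℕ) :
    (F.quotient N).I n = (F.I n).map (Ideal.Quotient.mk N) := rfl

lemma antitone (F : IdealFiltration A) : Antitone F.I :=
  antitone_nat_of_succ_le F.I_succ_le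

lemma pow_I_one_le (F : IdealFiltration A) (n : ℕ) : F.I 1 ^ n ≤ F.I n := by
  induction n with
  | zero => rw [F.I_zero]; exact le_top
  | succ n ih => rw [pow_succ]; exact (Ideal.mul_mono_left ih).trans (F.I_mul_le n 1)

variable {F : IdealFiltration A} {K : Ideal A}

lemma IsGoodFor.le_one (h : F.IsGoodFor K) : K ≤ F.I 1 := by
  have := h.1 0
  rwa [F.I_zero, Ideal.mul_top] at this

lemma IsGoodFor.exists_eq_pow_mul (h : F.IsGoodFor K) :
    ∃ c, ∀ n, F.I (c + n) = K ^ n * F.I c := by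
  obtain ⟨c, hc⟩ := eventually_atTop.1 h.2
  refine ⟨c, fun n => ?_⟩
  induction n with
  | zero => simp
  | succ n ih => rw [← add_assoc, hc _ (by omega), ih, pow_succ', mul_assoc]

lemma IsGoodFor.exists_le_pow (h : F.IsGoodFor K) : ∃ c, ∀ n, F.I (c + n) ≤ K ^ n := by
  obtain ⟨c, hc⟩ := h.exists_eq_pow_mul
  exact ⟨c, fun n => (hc n).le.trans Ideal.mul_le_left⟩

lemma IsGoodFor.map (h : F.IsGoodFor K) (f : A →+* B) : (F.map f).IsGoodFor (K.map f) := by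
  refine ⟨fun n => ?_, h.2.mono fun n hn => ?_⟩
  · rw [map_I, map_I, ← Ideal.map_mul]; exact Ideal.map_mono (h.1 n)
  · rw [map_I, map_I, ← Ideal.map_mul, hn]

/-- A family of ideals `E n ⊆ I_n` which is an `F`-filtration in the sense of Artin and Rees is
eventually generated by multiplication by powers of `K`. -/
lemma IsGoodFor.exists_eq_pow_mul_of_le [IsNoetherianRing A] (h : F.IsGoodFor K)
    (E : ℕ → Ideal A) (hE : ∀ n, E n ≤ F.I n) (hanti : ∀ n, E (n + 1) ≤ E n)
    (hK : ∀ n, K * E n ≤ E (n + 1)) :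
    ∃ c, ∀ n, E (c + n) = K ^ n * E c := by
  let F₁ : K.Filtration A := ⟨F.I, F.I_succ_le, h.1⟩
  let F₂ : K.Filtration A := ⟨E, hanti, hK⟩
  have h₁ : F₁.Stable := by
    obtain ⟨c, hc⟩ := eventually_atTop.1 h.2
    exact ⟨c, fun n hn => (hc n hn).symm⟩
  have h₂ : F₂.Stable := h₁.of_le (show F₂ ≤ F₁ from hE)
  exact h₂.exists_pow_smul_eq

/-- A filter-regular element is a nonzerodivisor on `I_n` for all large `n`. -/
lemma IsGoodFor.eventually_eq_zero_of_mul_eq_zero [IsNoetherianRing A] (h : F.IsGoodFor K)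
    {x : A} (hx : IsFilterRegular (F.I 1) x) :
    ∀ᶠ n in atTop, ∀ a ∈ F.I n, a * x = 0 → a = 0 := by
  let Z : Ideal A := LinearMap.ker (LinearMap.mulRight A x)
  have hZ : ∀ a, a ∈ Z ↔ a * x = 0 := fun a => by simp [Z]
  obtain ⟨c, hc⟩ := h.exists_eq_pow_mul_of_le (fun n => F.I n ⊓ Z) (fun n => inf_le_left)
    (fun n => inf_le_inf_right _ (F.I_succ_le n))
    (fun n => le_inf ((Ideal.mul_mono_right inf_le_left).trans (h.1 n))
      (Ideal.mul_le_right.trans inf_le_right))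
  -- `Z` is finitely generated, so a single power of `I_1` kills all of it
  have hfg : ∀ N : Ideal A, N.FG → N ≤ Z → ∃ r, F.I 1 ^ r * N = ⊥ := by
    intro N hN
    induction N, hN using Submodule.fg_induction with
    | singleton a =>
      intro ha
      obtain ⟨r, hr⟩ := hx a ((hZ a).1 (ha (Submodule.mem_span_singleton_self a)))
      refine ⟨r, eq_bot_iff.2 (Ideal.mul_le.2 fun b hb y hy => ?_)⟩
      obtain ⟨t, rfl⟩ := Ideal.mem_span_singleton'.1 hy
      rw [Ideal.mem_bot, mul_left_comm, mul_comm b, hr b hb, mul_zero]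
    | sup N₁ N₂ _ _ h₁ h₂ =>
      intro hle
      obtain ⟨r₁, hr₁⟩ := h₁ (le_sup_left.trans hle)
      obtain ⟨r₂, hr₂⟩ := h₂ (le_sup_right.trans hle)
      refine ⟨r₁ + r₂, ?_⟩
      rw [Ideal.mul_sup, pow_add, mul_assoc (_ ^ r₁) _ N₂, hr₂, mul_right_comm, hr₁]
      simp
  obtain ⟨r, hr⟩ := hfg Z (IsNoetherian.noetherian Z) le_rfl
  refine eventually_atTop.2 ⟨c + r, fun n hn a ha hax => ?_⟩
  have h1 : a ∈ F.I (c + r) ⊓ Z := ⟨F.antitone hn ha, (hZ a).2 hax⟩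
  rw [show F.I (c + r) ⊓ Z = K ^ r * (F.I c ⊓ Z) from hc r] at h1
  have h2 : K ^ r * (F.I c ⊓ Z) ≤ F.I 1 ^ r * Z :=
    Ideal.mul_mono (Ideal.pow_right_mono h.le_one r) inf_le_right
  simpa [hr] using h2 h1

end IdealFiltration

/-! ### General position -/

/-- A module over a local ring with infinite residue field is not a finite union of proper
submodules. -/
lemma IsLocalRing.exists_forall_notMem_of_infinite_residueField {A : Type*} [CommRing A]
    [IsLocalRing A] [Infinite (IsLocalRing.ResidueField A)] {M : Type*} [AddCommGroup M]
    [Module A M] (s : Finset (Submodule A M)) (hs : ⊤ ∉ s) : ∃ x : M, ∀ Q ∈ s, x ∉ Q := by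
  by_contra! hcon
  obtain ⟨Q, hQ, hfin⟩ := Submodule.exists_finiteIndex_of_cover (s := s) (by
    ext x; simpa using hcon x)
  have hfinite : Finite (M ⧸ Q) := AddSubgroup.finite_quotient_of_finiteIndex
  obtain ⟨v, hv⟩ : ∃ v : M, v ∉ Q := by
    by_contra! hall
    exact hs ((eq_top_iff.2 fun x _ => hall x : Q = ⊤) ▸ hQ)
  -- the multiples of a nonzero element of `M ⧸ Q` map onto the residue field
  let ψ : A →ₗ[A] M ⧸ Q := LinearMap.toSpanSingleton A _ (Q.mkQ v)
  have hker : LinearMap.ker ψ ≤ IsLocalRing.maximalIdeal A := by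
    refine IsLocalRing.le_maximalIdeal fun h => hv ?_
    have h1 : (1 : A) ∈ LinearMap.ker ψ := h ▸ Submodule.mem_top
    simpa [ψ] using h1
  have : Finite (A ⧸ LinearMap.ker ψ) :=
    Finite.of_injective _ (LinearMap.ker_eq_bot.1 (Submodule.ker_liftQ_eq_bot' _ ψ rfl))
  have : Finite (IsLocalRing.ResidueField A) :=
    Finite.of_surjective (Ideal.Quotient.factor hker) (Ideal.Quotient.factor_surjective hker)
  exact not_finite (IsLocalRing.ResidueField A)

/-- If every associated prime of `S ⧸ 𝔟` containing `z` contains `𝔞`, then the elements of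
`S ⧸ 𝔟` killed by `z` are killed by a common power of `𝔞`. -/
lemma Ideal.exists_pow_mul_mem_of_forall_associatedPrimes {S : Type*} [CommRing S]
    [IsNoetherianRing S] {𝔞 𝔟 : Ideal S} {z : S}
    (h : ∀ P ∈ associatedPrimes S (S ⧸ 𝔟), z ∈ P → 𝔞 ≤ P) :
    ∃ n, ∀ w ∈ 𝔞 ^ n, ∀ v, z * v ∈ 𝔟 → w * v ∈ 𝔟 := by
  let N : Submodule S (S ⧸ 𝔟) := LinearMap.ker (LinearMap.lsmul S (S ⧸ 𝔟) z)
  have hle : 𝔞 ≤ (Module.annihilator S N).radical := by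
    rw [Ideal.radical_eq_sInf, le_sInf_iff]
    rintro P ⟨hP, hPp⟩
    obtain ⟨p, hp, hpP⟩ := Ideal.exists_minimalPrimes_le hP
    refine le_trans (h p ?_ ?_) hpP
    · exact associatedPrimes.subset_of_injective (f := N.subtype) N.injective_subtype
        (Module.associatedPrimes.minimalPrimes_annihilator_subset_associatedPrimes S N hp)
    · refine hp.1.2 (Module.mem_annihilator.2 fun y => Subtype.ext ?_)
      exact y.2
  obtain ⟨n, hn⟩ := Ideal.exists_pow_le_of_le_radical_of_fg hle (IsNoetherian.noetherian 𝔞)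
  refine ⟨n, fun w hw v hv => ?_⟩
  have hmem : Ideal.Quotient.mk 𝔟 v ∈ N := by
    change z • Ideal.Quotient.mk 𝔟 v = 0
    rw [← Ideal.Quotient.mk_eq_mk, ← Submodule.Quotient.mk_smul]
    exact (Submodule.Quotient.mk_eq_zero _).2 hv
  have := congrArg Subtype.val (Module.mem_annihilator.1 (hn hw) ⟨_, hmem⟩)
  have h2 : w • Ideal.Quotient.mk 𝔟 v = 0 := this
  rw [← Ideal.Quotient.mk_eq_mk, ← Submodule.Quotient.mk_smul] at h2
  exact (Submodule.Quotient.mk_eq_zero _).1 h2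

/-! ### The Rees algebra -/

namespace IdealFiltration

variable {A : Type u} [CommRing A] (F : IdealFiltration A)

/-- The inclusion `a ↦ a t^n` of `I_n` into the Rees algebra. -/
noncomputable def reesMonomial (n : ℕ) : F.I n →ₗ[A] F.rees where
  toFun a := ⟨monomial n (a : A), fun m => by
    rw [coeff_monomial]
    split_ifs with h
    · exact h ▸ a.2
    · exact Ideal.zero_mem _⟩
  map_add' a b := Subtype.ext (by simp)
  map_smul' r a := Subtype.ext (by simp [smul_monomial])

@[simp] lemma coe_reesMonomial (n : ℕ) (a : F.I n) :
    (F.reesMonomial n a : A[X]) = monomial n (a : A) := rfl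

@[simp] lemma coe_algebraMap_rees (a : A) : (algebraMap A F.rees a : A[X]) = C a := rfl

@[simp] lemma reesProj_apply (p : F.rees) : F.reesProj p = (p : A[X]).coeff 0 := rfl

lemma reesMonomial_mul {m n : ℕ} (a : F.I m) (b : F.I n) :
    F.reesMonomial m a * F.reesMonomial n b =
      F.reesMonomial (m + n) ⟨a * b, F.I_mul_le m n (Ideal.mul_mem_mul a.2 b.2)⟩ :=
  Subtype.ext (by simp [monomial_mul_monomial])

lemma reesMonomial_pow {x : A} (hx : x ∈ F.I 1) (k : ℕ) :
    F.reesMonomial 1 ⟨x, hx⟩ ^ k =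
      F.reesMonomial k ⟨x ^ k, F.pow_I_one_le k (Ideal.pow_mem_pow hx k)⟩ :=
  Subtype.ext (by simp [monomial_pow])

lemma eq_sum_reesMonomial (p : F.rees) :
    p = ∑ n ∈ (p : A[X]).support, F.reesMonomial n ⟨(p : A[X]).coeff n, p.2 n⟩ :=
  Subtype.ext (by
    rw [AddSubmonoidClass.coe_finsetSum]
    exact (p : A[X]).as_sum_support)

/-- The homogeneous ideal `⨁ T_n t^n` of the Rees algebra, for ideals `T_n ⊆ A`. -/
def gradedIdeal (T : ℕ → Ideal A) (hT : ∀ m n, F.I m * T n ≤ T (m + n)) : Ideal F.rees where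
  carrier := {p | ∀ n, (p : A[X]).coeff n ∈ T n}
  add_mem' := by
    intro p q hp hq n
    rw [Subalgebra.coe_add, coeff_add]
    exact Ideal.add_mem _ (hp n) (hq n)
  zero_mem' n := by simp
  smul_mem' := by
    intro p q hq n
    rw [smul_eq_mul, Subalgebra.coe_mul, coeff_mul]
    refine Ideal.sum_mem _ fun c hc => ?_
    rw [← Finset.HasAntidiagonal.mem_antidiagonal.mp hc]
    exact hT _ _ (Ideal.mul_mem_mul (p.2 c.1) (hq c.2))

variable {F} in
lemma mem_gradedIdeal {T : ℕ → Ideal A} {hT : ∀ m n, F.I m * T n ≤ T (m + n)} {p : F.rees} :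
    p ∈ F.gradedIdeal T hT ↔ ∀ n, (p : A[X]).coeff n ∈ T n := Iff.rfl

variable {F} in
lemma reesMonomial_mem_gradedIdeal {T : ℕ → Ideal A} {hT : ∀ m n, F.I m * T n ≤ T (m + n)}
    {n : ℕ} {a : F.I n} : F.reesMonomial n a ∈ F.gradedIdeal T hT ↔ (a : A) ∈ T n := by
  rw [mem_gradedIdeal]
  refine ⟨fun h => by simpa using h n, fun h m => ?_⟩
  rw [coe_reesMonomial, coeff_monomial]
  split_ifs with h'
  · exact h' ▸ h
  · exact Ideal.zero_mem _

lemma map_algebraMap_rees (J : Ideal A) :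
    J.map (algebraMap A F.rees) = F.gradedIdeal (fun n => J * F.I n)
      (fun m n => by rw [mul_left_comm]; exact Ideal.mul_mono_right (F.I_mul_le m n)) := by
  apply le_antisymm
  · rw [Ideal.map_le_iff_le_comap]
    intro a ha n
    rw [coe_algebraMap_rees, coeff_C]
    split_ifs with h
    · subst h
      change a ∈ J * F.I 0
      rwa [F.I_zero, Ideal.mul_top]
    · exact Ideal.zero_mem _
  · intro p hp
    rw [F.eq_sum_reesMonomial p]
    refine Ideal.sum_mem _ fun n _ => ?_
    have key : J * F.I n ≤ Submodule.map (F.I n).subtype (Submodule.comap (F.reesMonomial n)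
        ((J.map (algebraMap A F.rees)).restrictScalars A)) := by
      refine Ideal.mul_le.2 fun j hj b hb => ⟨j • ⟨b, hb⟩, ?_, rfl⟩
      change F.reesMonomial n (j • ⟨b, hb⟩) ∈ J.map (algebraMap A F.rees)
      rw [map_smul, Algebra.smul_def]
      exact Ideal.mul_mem_right _ _ (Ideal.mem_map_of_mem _ hj)
    obtain ⟨a, ha, hae⟩ := key (hp n)
    have : a = ⟨(p : A[X]).coeff n, p.2 n⟩ := Subtype.ext hae
    exact this ▸ ha

lemma mem_map_algebraMap_rees {J : Ideal A} {p : F.rees} :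
    p ∈ J.map (algebraMap A F.rees) ↔ ∀ n, (p : A[X]).coeff n ∈ J * F.I n := by
  rw [map_algebraMap_rees, mem_gradedIdeal]

lemma reesMonomial_mem_map {J : Ideal A} {n : ℕ} {a : F.I n} :
    F.reesMonomial n a ∈ J.map (algebraMap A F.rees) ↔ (a : A) ∈ J * F.I n := by
  rw [map_algebraMap_rees, reesMonomial_mem_gradedIdeal]

/-- If `x_1, …, x_s` generate a reduction of `F`, then `R(F)` is a finite module over the
polynomial ring `A[X_1, …, X_s]`, where `X_i` acts as `x_i t`. -/
lemma IsGoodFor.finite_aeval [IsNoetherianRing A] {F : IdealFiltration A} {ι : Type*} {x : ι → A}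
    (h : F.IsGoodFor (Ideal.span (Set.range x))) :
    (MvPolynomial.aeval (R := A) fun i => F.reesMonomial 1
      ⟨x i, h.le_one (Ideal.subset_span ⟨i, rfl⟩)⟩).toRingHom.Finite := by
  set g := MvPolynomial.aeval (R := A) fun i => F.reesMonomial 1
      ⟨x i, h.le_one (Ideal.subset_span ⟨i, rfl⟩)⟩ with hg
  let _ : Algebra (MvPolynomial ι A) F.rees := g.toRingHom.toAlgebra
  have : IsScalarTower A (MvPolynomial ι A) F.rees := IsScalarTower.of_algHom g
  obtain ⟨c, hc⟩ := eventually_atTop.1 h.2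
  let W : Submodule (MvPolynomial ι A) F.rees := ⨆ n : Fin (c + 1),
    Submodule.span (MvPolynomial ι A) (LinearMap.range (F.reesMonomial n) : Set F.rees)
  have hmem : ∀ n (a : F.I n), F.reesMonomial n a ∈ W := by
    intro n
    induction n with
    | zero =>
      intro a
      exact Submodule.mem_iSup_of_mem (0 : Fin (c + 1)) (Submodule.subset_span ⟨a, rfl⟩)
    | succ n ih =>
      by_cases hn : n < c
      · intro a
        exact Submodule.mem_iSup_of_mem (⟨n + 1, by omega⟩ : Fin (c + 1))
          (Submodule.subset_span ⟨a, rfl⟩)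
      · have key : F.I (n + 1) ≤ Submodule.map (F.I (n + 1)).subtype
            (Submodule.comap (F.reesMonomial (n + 1)) (W.restrictScalars A)) := by
          refine (hc n (by omega)).le.trans ?_
          refine Ideal.mul_le.2 fun k hk b hb => ?_
          induction hk using Submodule.span_induction with
          | mem k hk =>
            obtain ⟨i, rfl⟩ := hk
            refine ⟨⟨x i * b, h.1 n (Ideal.mul_mem_mul (Ideal.subset_span ⟨i, rfl⟩) hb)⟩, ?_, rfl⟩
            have h1 := W.smul_mem (MvPolynomial.X i) (ih ⟨b, hb⟩)
            have h2 : (MvPolynomial.X i : MvPolynomial ι A) • F.reesMonomial n ⟨b, hb⟩ =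
                g (MvPolynomial.X i) * F.reesMonomial n ⟨b, hb⟩ := rfl
            rw [h2, hg, MvPolynomial.aeval_X] at h1
            have h3 : F.reesMonomial 1 ⟨x i, h.le_one (Ideal.subset_span ⟨i, rfl⟩)⟩ *
                F.reesMonomial n ⟨b, hb⟩ = F.reesMonomial (n + 1)
                  ⟨x i * b, h.1 n (Ideal.mul_mem_mul (Ideal.subset_span ⟨i, rfl⟩) hb)⟩ :=
              Subtype.ext (by simp [monomial_mul_monomial, add_comm])
            exact (congrArg (· ∈ W) h3).mp h1
          | zero => rw [zero_mul]; exact Submodule.zero_mem _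
          | add k l _ _ h₁ h₂ => rw [add_mul]; exact Submodule.add_mem _ h₁ h₂
          | smul r k _ h₁ => rw [smul_mul_assoc]; exact Submodule.smul_mem _ r h₁
        intro a
        obtain ⟨a', ha', hae⟩ := key a.2
        have : a' = a := Subtype.ext hae
        exact this ▸ ha'
  have htop : W = ⊤ := eq_top_iff.2 fun p _ => by
    rw [F.eq_sum_reesMonomial p]
    exact Submodule.sum_mem _ fun n _ => hmem n _
  change Module.Finite (MvPolynomial ι A) F.rees
  refine ⟨htop ▸ Submodule.fg_iSup _ fun n => ?_⟩
  obtain ⟨T, hT⟩ : (LinearMap.range (F.reesMonomial n)).FG := by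
    rw [LinearMap.range_eq_map]
    exact Submodule.FG.map _ (IsNoetherian.noetherian ⊤)
  exact ⟨T, by rw [← hT, Submodule.span_span_of_tower]⟩

lemma IsGoodFor.isNoetherianRing_rees [IsNoetherianRing A] {F : IdealFiltration A} {K : Ideal A}
    (h : F.IsGoodFor K) : IsNoetherianRing F.rees := by
  obtain ⟨s, hs⟩ := IsNoetherian.noetherian K
  have hs' : Ideal.span (Set.range ((↑) : s → A)) = K := by simpa using! hs
  rw [← hs'] at h
  have hfin := h.finite_aeval
  set g := (MvPolynomial.aeval (R := A) fun i : s => F.reesMonomial 1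
      ⟨i, h.le_one (Ideal.subset_span ⟨i, rfl⟩)⟩).toRingHom
  let _ : Algebra (MvPolynomial s A) F.rees := g.toAlgebra
  have : Module.Finite (MvPolynomial s A) F.rees := hfin
  exact IsNoetherianRing.of_finite (MvPolynomial s A) F.rees

end IdealFiltration

/-! ### Existence of weak-(FC)-elements -/

namespace IdealFiltration

/-- The ideal of the Rees algebra generated by `K t`. -/
noncomputable def reesSpan {A : Type u} [CommRing A] (F : IdealFiltration A) {K : Ideal A}
    (h : K ≤ F.I 1) : Ideal F.rees :=
  Ideal.span (Set.range fun k : K => F.reesMonomial 1 ⟨k, h k.2⟩)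

lemma reesMonomial_mem_reesSpan_pow {A : Type u} [CommRing A] (F : IdealFiltration A)
    {K : Ideal A} (h : K ≤ F.I 1) (n : ℕ) {w : A} (hw : w ∈ K ^ n) :
    F.reesMonomial n ⟨w, F.pow_I_one_le n (Ideal.pow_right_mono h n hw)⟩ ∈ F.reesSpan h ^ n := by
  have key : ∀ n, K ^ n ≤ Submodule.map (F.I n).subtype
      (Submodule.comap (F.reesMonomial n) ((F.reesSpan h ^ n).restrictScalars A)) := by
    intro n
    induction n with
    | zero =>
      intro w _
      exact ⟨⟨w, by rw [F.I_zero]; trivial⟩, by simp, rfl⟩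
    | succ n ih =>
      rw [pow_succ]
      refine Ideal.mul_le.2 fun a ha k hk => ?_
      obtain ⟨a', ha', rfl⟩ := ih ha
      refine ⟨⟨a' * k, F.I_mul_le n 1 (Ideal.mul_mem_mul a'.2 (h hk))⟩, ?_, rfl⟩
      have h1 : F.reesMonomial n a' * F.reesMonomial 1 ⟨k, h hk⟩ ∈ F.reesSpan h ^ (n + 1) :=
        pow_succ (F.reesSpan h) n ▸ Ideal.mul_mem_mul ha' (Ideal.subset_span ⟨⟨k, hk⟩, rfl⟩)
      rwa [reesMonomial_mul] at h1
  obtain ⟨a, ha, rfl⟩ := key n hw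
  exact ha

/-- Multiplication by `x t` is injective in large degrees on `R(F) / ⨁ T_n t^n`, provided that
the associated primes of this module that contain `x t` contain `K t`. -/
lemma IsGoodFor.eventually_mem_of_mul_mem {A : Type u} [CommRing A] [IsNoetherianRing A]
    {F : IdealFiltration A} {K : Ideal A} (h : F.IsGoodFor K) {T : ℕ → Ideal A}
    (hT : ∀ m n, F.I m * T n ≤ T (m + n)) (hanti : ∀ n, T (n + 1) ≤ T n)
    {x : A} (hx : x ∈ F.I 1)
    (hass : ∀ P ∈ associatedPrimes F.rees (F.rees ⧸ F.gradedIdeal T hT),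
      F.reesMonomial 1 ⟨x, hx⟩ ∈ P → F.reesSpan h.le_one ≤ P) :
    ∀ᶠ n in atTop, ∀ b ∈ F.I n, x * b ∈ T (n + 1) → b ∈ T n := by
  have := h.isNoetherianRing_rees
  obtain ⟨r, hr⟩ := Ideal.exists_pow_mul_mem_of_forall_associatedPrimes hass
  obtain ⟨c, hc⟩ := h.exists_eq_pow_mul_of_le
    (fun n => F.I n ⊓ Submodule.comap (LinearMap.mulLeft A x) (T (n + 1))) (fun n => inf_le_left)
    (fun n b hb => ⟨F.I_succ_le n hb.1, hanti _ hb.2⟩) (by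
      refine fun n => Ideal.mul_le.2 fun k hk b hb => ⟨h.1 n (Ideal.mul_mem_mul hk hb.1), ?_⟩
      change x * (k * b) ∈ T (n + 1 + 1)
      rw [mul_left_comm, add_comm (n + 1)]
      exact hT 1 (n + 1) (Ideal.mul_mem_mul (h.le_one hk) hb.2))
  refine eventually_atTop.2 ⟨c + r, fun n hn b hb hxb => ?_⟩
  obtain ⟨k, rfl⟩ := Nat.exists_eq_add_of_le hn
  have h1 : b ∈ K ^ (r + k) * (F.I c ⊓ Submodule.comap (LinearMap.mulLeft A x) (T (c + 1))) := by
    rw [← hc (r + k), ← add_assoc]; exact ⟨hb, hxb⟩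
  rw [show c + r + k = k + (r + c) by ring]
  refine (?_ : K ^ (r + k) * _ ≤ T (k + (r + c))) h1
  rw [add_comm r, pow_add, mul_assoc]
  refine (Ideal.mul_mono ((Ideal.pow_right_mono h.le_one k).trans (F.pow_I_one_le k))
    (?_ : _ ≤ T (r + c))).trans (hT k _)
  refine Ideal.mul_le.2 fun w hw a ha => ?_
  have h2 := hr _ (F.reesMonomial_mem_reesSpan_pow h.le_one r hw) (F.reesMonomial c ⟨a, ha.1⟩)
    (by
      rw [reesMonomial_mul, reesMonomial_mem_gradedIdeal]
      exact (congrArg (x * a ∈ T ·) (add_comm c 1)).mp ha.2)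
  rwa [reesMonomial_mul, reesMonomial_mem_gradedIdeal] at h2

variable {A : Type u} [CommRing A]

lemma monomial_mem_map_reesAlgebra {J N : Ideal A} {m : ℕ} {a : A} (ha : a ∈ J ^ m * N) :
    ∃ h : monomial m a ∈ reesAlgebra J,
      (⟨monomial m a, h⟩ : reesAlgebra J) ∈ N.map (algebraMap A (reesAlgebra J)) := by
  induction ha using Submodule.mul_induction_on' with
  | mem_mul_mem j hj b hb =>
    have hj' : monomial m j ∈ reesAlgebra J := reesAlgebra.monomial_mem.2 hj
    refine ⟨reesAlgebra.monomial_mem.2 (Ideal.mul_mem_right _ _ hj), ?_⟩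
    have h1 := Ideal.mul_mem_left (N.map (algebraMap A (reesAlgebra J))) ⟨_, hj'⟩
      (Ideal.mem_map_of_mem _ hb)
    convert h1 using 1
    refine Subtype.ext ?_
    change monomial m (j * b) = monomial m j * C b
    rw [monomial_mul_C]
  | add a _ b _ h₁ h₂ =>
    obtain ⟨h₁, h₁'⟩ := h₁
    obtain ⟨h₂, h₂'⟩ := h₂
    refine ⟨by rw [map_add]; exact add_mem h₁ h₂, ?_⟩
    convert Ideal.add_mem _ h₁' h₂' using 1
    exact Subtype.ext (map_add _ _ _)

lemma coeff_mem_of_mem_map_reesAlgebra {J N : Ideal A} {p : reesAlgebra J}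
    (hp : p ∈ N.map (algebraMap A (reesAlgebra J))) (m : ℕ) : (p : A[X]).coeff m ∈ J ^ m * N := by
  induction hp using Submodule.span_induction generalizing m with
  | mem p hp =>
    obtain ⟨a, ha, rfl⟩ := hp
    change (C a).coeff m ∈ _
    rw [coeff_C]
    split_ifs with h
    · subst h; simpa using ha
    · exact Ideal.zero_mem _
  | zero => simp
  | add p q _ _ h₁ h₂ => exact Ideal.add_mem _ (h₁ m) (h₂ m)
  | smul r p _ h =>
    rw [smul_eq_mul, Subalgebra.coe_mul, coeff_mul]
    refine Ideal.sum_mem _ fun c hc => ?_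
    rw [← Finset.HasAntidiagonal.mem_antidiagonal.mp hc, pow_add, mul_assoc]
    exact Ideal.mul_mem_mul (r.2 c.1) (h c.2)

/-- In the extension of `F` to the Rees algebra `A[Js]`, the component of `I_n A[Js]` in degree
`m` is `J^m I_n`. -/
lemma monomial_mem_map_reesAlgebra_iff {J N : Ideal A} {m : ℕ} {a : A}
    (h : monomial m a ∈ reesAlgebra J) :
    (⟨monomial m a, h⟩ : reesAlgebra J) ∈ N.map (algebraMap A (reesAlgebra J)) ↔
      a ∈ J ^ m * N := by
  refine ⟨fun h' => by simpa using coeff_mem_of_mem_map_reesAlgebra h' m, fun ha => ?_⟩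
  obtain ⟨_, h'⟩ := monomial_mem_map_reesAlgebra ha
  exact h'

variable {F : IdealFiltration A} {J K : Ideal A}

/-- The condition (FC₁), deduced from the regularity of `x` in large degrees on the bigraded rings
`⨁ J^m I_n / J^m I_{n+1}` and `⨁ J^m I_n / J^{m+1} I_n`: the lemma of Artin and Rees puts a
preimage of an element of `J^m I_{n+1} ∩ (x)` into some `I_N`, and the two hypotheses then move it
up to `J^m I_n`. -/
lemma IsGoodFor.eventually_pow_mul_inf_span_eq [IsNoetherianRing A] (h : F.IsGoodFor K) {x : A}
    (hx : x ∈ F.I 1)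
    (h₁ : ∀ᶠ n in atTop, ∀ m, ∀ a ∈ J ^ m * F.I n, x * a ∈ J ^ m * F.I (n + 2) →
      a ∈ J ^ m * F.I (n + 1))
    (h₂ : ∀ᶠ n in atTop, ∀ m, ∀ a ∈ J ^ m * F.I n, x * a ∈ J ^ (m + 1) * F.I (n + 1) →
      a ∈ J ^ (m + 1) * F.I n) :
    ∀ᶠ n in atTop, ∀ m : ℕ,
      J ^ m * F.I (n + 1) ⊓ Ideal.span {x} = J ^ m * (Ideal.span {x} * F.I n) := by
  obtain ⟨N, hN⟩ := eventually_atTop.1 (h₁.and h₂)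
  obtain ⟨c, hc⟩ := h.exists_eq_pow_mul_of_le (fun n => F.I n ⊓ Ideal.span {x})
    (fun n => inf_le_left) (fun n => inf_le_inf_right _ (F.I_succ_le n))
    (fun n => le_inf ((Ideal.mul_mono_right inf_le_left).trans (h.1 n))
      (Ideal.mul_le_right.trans inf_le_right))
  refine eventually_atTop.2 ⟨c + N, fun n hn m => le_antisymm ?_ (le_inf ?_ ?_)⟩
  · rintro y ⟨hy, hyx⟩
    have hy1 : y ∈ F.I (c + N) ⊓ Ideal.span {x} :=
      ⟨F.antitone (by omega) (Ideal.mul_le_right hy), hyx⟩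
    have hle : F.I (c + N) ⊓ Ideal.span {x} ≤ F.I N * Ideal.span {x} :=
      (hc N).le.trans (Ideal.mul_mono
        ((Ideal.pow_right_mono h.le_one N).trans (F.pow_I_one_le N)) inf_le_right)
    have hy2 := hle hy1
    obtain ⟨a, ha, rfl⟩ := Ideal.mem_mul_span_singleton.1 hy2
    have hm : ∀ k ≤ m, a ∈ J ^ k * F.I N := by
      intro k
      induction k with
      | zero => intro _; simpa using ha
      | succ k ih =>
        intro hk
        refine (hN N le_rfl).2 k a (ih (by omega)) ?_
        rw [mul_comm x]
        have hle : J ^ m * F.I (n + 1) ≤ J ^ (k + 1) * F.I (N + 1) :=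
          Ideal.mul_mono (Ideal.pow_le_pow_right hk) (F.antitone (by omega))
        exact hle hy
    have hn' : ∀ k, N + k ≤ n → a ∈ J ^ m * F.I (N + k) := by
      intro k
      induction k with
      | zero => exact fun _ => hm m le_rfl
      | succ k ih =>
        intro hk
        refine (hN (N + k) (by omega)).1 m a (ih (by omega)) ?_
        rw [mul_comm x]
        have hle : J ^ m * F.I (n + 1) ≤ J ^ m * F.I (N + k + 2) :=
          Ideal.mul_mono_right (F.antitone (by omega))
        exact hle hy
    have := hn' (n - N) (by omega)
    rw [Nat.add_sub_cancel' (by omega)] at this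
    rw [mul_left_comm, mul_comm a]
    exact Ideal.mul_mem_mul (Ideal.mem_span_singleton_self x) this
  · refine Ideal.mul_mono_right ?_
    rw [add_comm n]
    exact (Ideal.mul_mono_left (by simpa using hx)).trans (F.I_mul_le 1 n)
  · exact Ideal.mul_le_right.trans Ideal.mul_le_left

/-- An element `x` of `K` in general position is regular in large degrees on finitely many
residue class rings of the Rees algebra of a filtration of an `A`-algebra. -/
lemma IsGoodFor.exists_eventually_mem_of_mul_mem [IsLocalRing A]
    [Infinite (IsLocalRing.ResidueField A)] {B : Type u} [CommRing B] [IsNoetherianRing B]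
    [Algebra A B] {G : IdealFiltration B} (h : G.IsGoodFor (K.map (algebraMap A B)))
    {ι : Type*} [Finite ι] (T : ι → ℕ → Ideal B)
    (hT : ∀ i m n, G.I m * T i n ≤ T i (m + n)) (hanti : ∀ i n, T i (n + 1) ≤ T i n) :
    ∃ x ∈ K, ∀ i, ∀ᶠ n in atTop, ∀ b ∈ G.I n,
      algebraMap A B x * b ∈ T i (n + 1) → b ∈ T i n := by
  have := h.isNoetherianRing_rees
  have hK : ∀ k ∈ K, algebraMap A B k ∈ G.I 1 :=
    fun k hk => h.le_one (Ideal.mem_map_of_mem _ hk)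
  let V (P : Ideal G.rees) : Submodule A K :=
    { carrier := {k | G.reesMonomial 1 ⟨_, hK k k.2⟩ ∈ P}
      add_mem' := fun {a b} ha hb => by
        have h1 := P.add_mem ha hb
        rw [← map_add] at h1
        have h2 : (⟨_, hK a a.2⟩ + ⟨_, hK b b.2⟩ : G.I 1) = ⟨_, hK (a + b : K) (a + b).2⟩ :=
          Subtype.ext (map_add _ _ _).symm
        exact (congrArg (G.reesMonomial 1 · ∈ P) h2).mp h1
      zero_mem' := by
        have h2 : (0 : G.I 1) = ⟨_, hK (0 : K) (0 : K).2⟩ := Subtype.ext (map_zero _).symm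
        have h1 := P.zero_mem
        rw [← map_zero (G.reesMonomial 1)] at h1
        exact (congrArg (G.reesMonomial 1 · ∈ P) h2).mp h1
      smul_mem' := fun r a ha => by
        have h1 := P.mul_mem_left (algebraMap B G.rees (algebraMap A B r)) ha
        rw [← Algebra.smul_def, ← map_smul] at h1
        have h2 : (algebraMap A B r • ⟨_, hK a a.2⟩ : G.I 1) = ⟨_, hK (r • a : K) (r • a).2⟩ :=
          Subtype.ext (map_mul _ _ _).symm
        exact (congrArg (G.reesMonomial 1 · ∈ P) h2).mp h1 }
  have hV : ∀ P, V P = ⊤ → G.reesSpan h.le_one ≤ P := by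
    refine fun P hP => Ideal.span_le.2 ?_
    rintro _ ⟨⟨k, hk⟩, rfl⟩
    have key : K.map (algebraMap A B) ≤ Submodule.map (G.I 1).subtype
        (Submodule.comap (G.reesMonomial 1) (P.restrictScalars B)) := by
      refine Ideal.map_le_iff_le_comap.2 fun a ha => ?_
      have h1 : (⟨a, ha⟩ : K) ∈ V P := hP ▸ Submodule.mem_top
      exact ⟨_, h1, rfl⟩
    obtain ⟨a, ha, hae⟩ := key hk
    have h2 : a = ⟨k, h.le_one hk⟩ := Subtype.ext hae
    exact (congrArg (G.reesMonomial 1 · ∈ P) h2).mp ha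
  have hfin : Set.Finite (⋃ i, associatedPrimes G.rees (G.rees ⧸ G.gradedIdeal (T i) (hT i))) :=
    Set.finite_iUnion fun i => associatedPrimes.finite _ _
  obtain ⟨x, hx⟩ := IsLocalRing.exists_forall_notMem_of_infinite_residueField
    ((hfin.subset (Set.sep_subset _ fun P => ¬ G.reesSpan h.le_one ≤ P)).image V).toFinset (by
      rw [Set.Finite.mem_toFinset]
      rintro ⟨P, ⟨-, hP⟩, hPt⟩
      exact hP (hV P hPt))
  refine ⟨x, x.2, fun i => h.eventually_mem_of_mul_mem (hT i) (hanti i) (hK x x.2)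
    fun P hP hxP => ?_⟩
  by_contra hcon
  refine hx (V P) ?_ hxP
  rw [Set.Finite.mem_toFinset]
  exact ⟨P, ⟨Set.mem_iUnion_of_mem i hP, hcon⟩, rfl⟩

/-- Every reduction of a non-nilpotent filtration contains a weak-(FC)-element, namely any
element in general position with respect to the associated primes of three graded modules. -/
theorem IsGoodFor.exists_isWeakFCElement [IsNoetherianRing A] [IsLocalRing A]
    [Infinite (IsLocalRing.ResidueField A)] (h : F.IsGoodFor K) (h₁ : F.I 1 ≠ ⊤)
    (hnil : ¬ F.IsNilpotent) (J : Ideal A) : ∃ x ∈ K, F.IsWeakFCElement J x := by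
  let B := reesAlgebra J
  let f : A →+* B := algebraMap A B
  let G : IdealFiltration B := F.map f
  -- the homogeneous ideals whose residue class rings are `R(G)`, `gr(G)` and the fiber cone of
  -- the extension `G` of `F` to `A[Js]`
  let T : Fin 3 → ℕ → Ideal B := ![fun _ => ⊥, fun n => G.I (n + 1), fun n => J.map f * G.I n]
  have hT : ∀ i m n, G.I m * T i n ≤ T i (m + n) := by
    intro i m n
    fin_cases i
    · simp [T]
    · exact G.I_mul_le m (n + 1)
    · change G.I m * (J.map f * G.I n) ≤ J.map f * G.I (m + n)
      rw [mul_left_comm]; exact Ideal.mul_mono_right (G.I_mul_le m n)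
  have hanti : ∀ i n, T i (n + 1) ≤ T i n := by
    intro i n
    fin_cases i
    · exact le_rfl
    · exact G.I_succ_le _
    · exact Ideal.mul_mono_right (G.I_succ_le n)
  obtain ⟨x, hxK, hreg⟩ := IsGoodFor.exists_eventually_mem_of_mul_mem (h.map f) T hT hanti
  have hxmon : ∀ m (a : A) (ha : monomial m a ∈ B), ∃ ha' : monomial m (x * a) ∈ B,
      f x * (⟨monomial m a, ha⟩ : B) = ⟨monomial m (x * a), ha'⟩ := by
    intro m a ha
    refine ⟨reesAlgebra.monomial_mem.2 (Ideal.mul_mem_left _ _ (reesAlgebra.monomial_mem.1 ha)),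
      Subtype.ext ?_⟩
    change C x * monomial m a = _
    rw [C_mul_monomial]
  refine ⟨x, hxK, ⟨⟨h₁, K, h⟩, hnil⟩, h.le_one hxK,
    h.eventually_pow_mul_inf_span_eq (h.le_one hxK) ?_ ?_, ?_⟩
  · filter_upwards [hreg 1] with n hn m a ha hxa
    have haB : monomial m a ∈ B := reesAlgebra.monomial_mem.2 (Ideal.mul_le_left ha)
    obtain ⟨haB', hmul⟩ := hxmon m a haB
    refine (monomial_mem_map_reesAlgebra_iff haB).1 (hn _
      ((monomial_mem_map_reesAlgebra_iff haB).2 ha) ?_)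
    rw [hmul]
    exact (monomial_mem_map_reesAlgebra_iff haB').2 hxa
  · filter_upwards [hreg 2] with n hn m a ha hxa
    have haB : monomial m a ∈ B := reesAlgebra.monomial_mem.2 (Ideal.mul_le_left ha)
    obtain ⟨haB', hmul⟩ := hxmon m a haB
    have hT2 : ∀ n, T 2 n = (J * F.I n).map f := fun n => (Ideal.map_mul f _ _).symm
    have key := hn _ ((monomial_mem_map_reesAlgebra_iff haB).2 ha)
    rw [hmul, hT2, hT2] at key
    have key2 := (monomial_mem_map_reesAlgebra_iff haB).1
      (key ((monomial_mem_map_reesAlgebra_iff haB').2 (by rwa [← mul_assoc, ← pow_succ])))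
    rwa [← mul_assoc, ← pow_succ] at key2
  · intro a hax
    obtain ⟨n, hn⟩ := eventually_atTop.1 (hreg 0)
    refine ⟨n, fun b hb => ?_⟩
    have key := hn n le_rfl (f (b * a)) (Ideal.mem_map_of_mem f
      (Ideal.mul_mem_right _ _ (F.pow_I_one_le n hb))) (by
        change f x * f (b * a) ∈ (⊥ : Ideal B)
        rw [← map_mul, mul_left_comm, mul_comm x, hax, mul_zero, map_zero]
        exact Ideal.zero_mem _)
    have h0 : f (b * a) = 0 := key
    have h1 : C (b * a) = (0 : A[X]) := congrArg Subtype.val h0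
    rw [mul_comm]; exact C_eq_zero.1 h1

end IdealFiltration

/-! ### The dimension of the fiber cone -/

/-- The dimension does not increase along an integral extension (incomparability). -/
lemma ringKrullDim_le_of_isIntegral {R S : Type*} [CommRing R] [CommRing S] (g : R →+* S)
    (hg : g.IsIntegral) : ringKrullDim S ≤ ringKrullDim R := by
  algebraize [g]
  have : Algebra.IsIntegral R S := ⟨hg⟩
  refine Order.krullDim_le_of_strictMono (PrimeSpectrum.comap g) fun P Q hPQ => ?_
  exact Ideal.IsIntegral.comap_lt_comap (R := R) (I := P.asIdeal) (J := Q.asIdeal) hPQ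

lemma Ideal.exists_notMem_mul_pow_eq_zero_of_mem_minimalPrimes {R : Type*} [CommRing R]
    {P : Ideal R} (hP : P ∈ minimalPrimes R) {x : R} (hx : x ∈ P) :
    ∃ u ∉ P, ∃ k : ℕ, u * x ^ k = 0 := by
  have hPp : P.IsPrime := hP.isPrime
  have : Ring.KrullDimLE 0 (Localization.AtPrime P) := Ring.KrullDimLE.of_isLocalization P hP _
  obtain ⟨k, hk⟩ := Ring.KrullDimLE.isNilpotent_iff_mem_maximalIdeal.2
    ((IsLocalization.AtPrime.to_map_mem_maximal_iff (Localization.AtPrime P) P x).2 hx)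
  rw [← map_pow, IsLocalization.map_eq_zero_iff P.primeCompl] at hk
  obtain ⟨u, hu⟩ := hk
  exact ⟨u, u.2, k, hu⟩

lemma krullDimLE_zero_quotient_of_radical_eq {A : Type*} [CommRing A] [IsLocalRing A]
    {J : Ideal A} (hJ : J.radical = IsLocalRing.maximalIdeal A) : Ring.KrullDimLE 0 (A ⧸ J) := by
  rw [Ideal.krullDimLE_zero_quotient_iff_forall_minimalPrimes_isMaximal]
  intro P hP
  rw [← Ideal.radical_minimalPrimes, hJ, Ideal.minimalPrimes_eq_subsingleton_self] at hP
  rw [Set.mem_singleton_iff.1 hP]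
  infer_instance

namespace IdealFiltration

variable {A : Type u} [CommRing A] {F : IdealFiltration A} {J : Ideal A}

lemma reesProj_surjective (F : IdealFiltration A) : Function.Surjective F.reesProj :=
  fun a => ⟨algebraMap A F.rees a, by simp⟩

lemma fiberMk_surjective (F : IdealFiltration A) (J : Ideal A) :
    Function.Surjective (F.fiberMk J) := Ideal.Quotient.mk_surjective

lemma fiberMk_eq_zero {p : F.rees} :
    F.fiberMk J p = 0 ↔ ∀ n, (p : A[X]).coeff n ∈ J * F.I n := by
  rw [← mem_map_algebraMap_rees]
  exact Ideal.Quotient.eq_zero_iff_mem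

lemma ker_fiberMk : RingHom.ker (F.fiberMk J) = J.map (algebraMap A F.rees) := Ideal.mk_ker

lemma IsGoodFor.isNoetherianRing_fiberCone [IsNoetherianRing A] {K : Ideal A}
    (h : F.IsGoodFor K) (J : Ideal A) : IsNoetherianRing (F.fiberCone J) := by
  have := h.isNoetherianRing_rees
  exact isNoetherianRing_of_surjective _ _ (F.fiberMk J) (F.fiberMk_surjective J)

/-- The dimension of the fiber cone is at most the number of generators of a reduction. -/
theorem IsGoodFor.ringKrullDim_fiberCone_le [IsNoetherianRing A] [IsLocalRing A]
    (hJ : J.radical = IsLocalRing.maximalIdeal A) {s : ℕ} {x : Fin s → A}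
    (h : F.IsGoodFor (Ideal.span (Set.range x))) : ringKrullDim (F.fiberCone J) ≤ s := by
  have hdim := krullDimLE_zero_quotient_of_radical_eq hJ
  have hJtop : J ≠ ⊤ := by
    rintro rfl
    rw [Ideal.radical_top] at hJ
    exact (IsLocalRing.maximalIdeal.isMaximal A).ne_top hJ.symm
  have : Nontrivial (A ⧸ J) := Ideal.Quotient.nontrivial_iff.2 hJtop
  let y (i : Fin s) : F.rees :=
    F.reesMonomial 1 ⟨x i, h.le_one (Ideal.subset_span ⟨i, rfl⟩)⟩
  let g₀ : A ⧸ J →+* F.fiberCone J := Ideal.Quotient.lift J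
    ((F.fiberMk J).comp (algebraMap A F.rees)) fun a ha =>
      Ideal.Quotient.eq_zero_iff_mem.2 (Ideal.mem_map_of_mem _ ha)
  let g : MvPolynomial (Fin s) (A ⧸ J) →+* F.fiberCone J :=
    MvPolynomial.eval₂Hom g₀ fun i => F.fiberMk J (y i)
  have hcomp : g.comp (MvPolynomial.map (Ideal.Quotient.mk J)) =
      (F.fiberMk J).comp (MvPolynomial.aeval (R := A) y).toRingHom := by
    refine MvPolynomial.ringHom_ext (fun a => ?_) fun i => ?_
    · simp only [g, g₀, RingHom.comp_apply, MvPolynomial.map_C, MvPolynomial.coe_eval₂Hom,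
        MvPolynomial.eval₂_C]
      exact (congrArg _ (MvPolynomial.algHom_C (MvPolynomial.aeval y) a)).symm
    · simp [g]
  have hfin : g.Finite := by
    refine RingHom.Finite.of_comp_finite (f := MvPolynomial.map (Ideal.Quotient.mk J)) ?_
    rw [hcomp]
    exact (RingHom.Finite.of_surjective _ (F.fiberMk_surjective J)).comp h.finite_aeval
  refine (ringKrullDim_le_of_isIntegral g hfin.to_isIntegral).trans ?_
  rw [MvPolynomial.ringKrullDim_of_isNoetherianRing, Nat.card_fin,
    ringKrullDimZero_iff_ringKrullDim_eq_zero.1 hdim, zero_add]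

/-- A weak-(FC)-element `x` is regular on the fiber cone in large degrees: if `b ∈ I_n` and
`x b ∈ J I_{n+1}`, then `b ∈ J I_n`. -/
lemma IsWeakFCElement.eventually_mem_of_mul_mem [IsNoetherianRing A] {x : A}
    (hx : F.IsWeakFCElement J x) :
    ∀ᶠ n in atTop, ∀ b ∈ F.I n, x * b ∈ J * F.I (n + 1) → b ∈ J * F.I n := by
  obtain ⟨⟨⟨-, K, hK⟩, -⟩, hx1, hFC, hreg⟩ := hx
  filter_upwards [hFC, hK.eventually_eq_zero_of_mul_eq_zero hreg] with n hn hinj b hb hxb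
  have h1 : x * b ∈ J ^ 1 * F.I (n + 1) ⊓ Ideal.span {x} :=
    ⟨by rwa [pow_one], Ideal.mul_mem_right _ _ (Ideal.mem_span_singleton_self x)⟩
  rw [hn 1, pow_one, mul_left_comm, Ideal.mem_span_singleton_mul] at h1
  obtain ⟨c, hc, hxc⟩ := h1
  have h2 : b - c = 0 := hinj _ (Ideal.sub_mem _ hb (Ideal.mul_le_right hc))
    (by rw [sub_mul, mul_comm b, mul_comm c, hxc, sub_self])
  rwa [sub_eq_zero.1 h2]

section Local

variable [IsLocalRing A]

/-- The maximal homogeneous ideal of the fiber cone. -/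
noncomputable def fiberMax (F : IdealFiltration A) (J : Ideal A) : Ideal (F.fiberCone J) :=
  F.reesMax.map (F.fiberMk J)

lemma mem_reesMax {p : F.rees} :
    p ∈ F.reesMax ↔ (p : A[X]).coeff 0 ∈ IsLocalRing.maximalIdeal A := Iff.rfl

instance reesMax_isMaximal (F : IdealFiltration A) : F.reesMax.IsMaximal :=
  Ideal.comap_isMaximal_of_surjective _ F.reesProj_surjective

lemma ker_fiberMk_le_reesMax (hJ : J ≤ IsLocalRing.maximalIdeal A) :
    RingHom.ker (F.fiberMk J) ≤ F.reesMax := fun p hp => by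
  have := fiberMk_eq_zero.1 hp 0
  rw [mem_reesMax]
  exact hJ (Ideal.mul_le_left this)

lemma comap_fiberMax (hJ : J ≤ IsLocalRing.maximalIdeal A) :
    (F.fiberMax J).comap (F.fiberMk J) = F.reesMax := by
  rw [fiberMax, Ideal.comap_map_of_surjective' _ (F.fiberMk_surjective J)]
  exact sup_eq_left.2 (ker_fiberMk_le_reesMax hJ)

lemma fiberMk_mem_fiberMax (hJ : J ≤ IsLocalRing.maximalIdeal A) {p : F.rees} :
    F.fiberMk J p ∈ F.fiberMax J ↔ (p : A[X]).coeff 0 ∈ IsLocalRing.maximalIdeal A := by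
  rw [← mem_reesMax, ← comap_fiberMax hJ, Ideal.mem_comap]

lemma fiberMax_isMaximal (hJ : J ≤ IsLocalRing.maximalIdeal A) : (F.fiberMax J).IsMaximal := by
  refine (Ideal.map_eq_top_or_isMaximal_of_surjective _ (F.fiberMk_surjective J)
    F.reesMax_isMaximal).resolve_left fun h => ?_
  have h1 := comap_fiberMax (F := F) hJ
  rw [fiberMax, h, Ideal.comap_top] at h1
  exact F.reesMax_isMaximal.ne_top h1.symm

/-- For a weak-(FC)-element `x`, the element `x t` of the fiber cone lies in no minimal prime `P`.
Otherwise `u (x t)^k = 0` for some `u` outside `P`. As `x t` is regular in large degrees, `u` kills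
the fiber cone in large degrees, so `P` is the maximal homogeneous ideal and the constant term of
`u` is a unit. Thus `(x t)^k = 0`, and `F` is nilpotent, a contradiction. -/
lemma IsWeakFCElement.notMem_minimalPrimes [IsNoetherianRing A]
    (hJ : J.radical = IsLocalRing.maximalIdeal A) {x : A} (hx : F.IsWeakFCElement J x)
    {P : Ideal (F.fiberCone J)}
    (hxP : F.fiberMk J (F.reesMonomial 1 ⟨x, hx.2.1⟩) ∈ P) : P ∉ minimalPrimes (F.fiberCone J) := by
  intro hP
  have hPp : P.IsPrime := hP.isPrime
  have hJm : J ≤ IsLocalRing.maximalIdeal A := hJ ▸ Ideal.le_radical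
  obtain ⟨N, hN⟩ := eventually_atTop.1 hx.eventually_mem_of_mul_mem
  have hNk : ∀ k n, N ≤ n → ∀ b ∈ F.I n, x ^ k * b ∈ J * F.I (n + k) → b ∈ J * F.I n := by
    intro k
    induction k with
    | zero => intro n _ b _ h; simpa using h
    | succ k ih =>
      intro n hn b hb h
      refine hN n hn b hb (ih (n + 1) (by omega) _ ?_ ?_)
      · rw [add_comm]; exact F.I_mul_le 1 n (Ideal.mul_mem_mul hx.2.1 hb)
      · rw [← mul_assoc, ← pow_succ]; convert h using 3; ring
  obtain ⟨u, hu, k, huk⟩ := Ideal.exists_notMem_mul_pow_eq_zero_of_mem_minimalPrimes hP hxP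
  obtain ⟨p, rfl⟩ := F.fiberMk_surjective J u
  have hpk : ∀ j, (p : A[X]).coeff j * x ^ k ∈ J * F.I (j + k) := by
    intro j
    rw [← map_pow, ← map_mul, reesMonomial_pow, fiberMk_eq_zero] at huk
    simpa [coeff_mul_monomial] using huk (j + k)
  have hmon : ∀ n, N ≤ n → ∀ w : F.I n, F.fiberMk J (F.reesMonomial n w) ∈ P := by
    intro n hn w
    have h0 : F.fiberMk J p * F.fiberMk J (F.reesMonomial n w) = 0 := by
      rw [← map_mul, fiberMk_eq_zero]
      intro j
      rw [Subalgebra.coe_mul, coe_reesMonomial, ← C_mul_X_pow_eq_monomial, ← mul_assoc,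
        coeff_mul_X_pow', coeff_mul_C]
      split_ifs with hj
      · obtain ⟨i, rfl⟩ := Nat.exists_eq_add_of_le' hj
        rw [Nat.add_sub_cancel]
        refine hNk k _ (by omega) _ (F.I_mul_le _ _ (Ideal.mul_mem_mul (p.2 i) w.2)) ?_
        have h1 := Ideal.mul_mem_mul (hpk i) w.2
        rw [mul_assoc] at h1
        rw [← mul_assoc, mul_comm (x ^ k), show i + n + k = i + k + n by ring]
        exact Ideal.mul_mono_right (F.I_mul_le (i + k) n) h1
      · exact Ideal.zero_mem _
    exact (hPp.mem_or_mem (h0 ▸ P.zero_mem)).resolve_left hu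
  have hle : F.fiberMax J ≤ P := by
    refine Ideal.map_le_iff_le_comap.2 fun q hq => ?_
    rw [F.eq_sum_reesMonomial q]
    refine Ideal.sum_mem _ fun n _ => ?_
    rw [Ideal.mem_comap]
    rcases Nat.eq_zero_or_pos n with rfl | hn
    · obtain ⟨r, hr⟩ : (q : A[X]).coeff 0 ∈ J.radical := hJ ▸ hq
      refine hPp.mem_of_pow_mem r ?_
      have h0 : F.reesMonomial 0 ⟨(q : A[X]).coeff 0, q.2 0⟩ =
          algebraMap A F.rees ((q : A[X]).coeff 0) := Subtype.ext (by simp)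
      rw [h0, ← map_pow, ← map_pow,
        show F.fiberMk J (algebraMap A F.rees _) = 0 from
          Ideal.Quotient.eq_zero_iff_mem.2 (Ideal.mem_map_of_mem _ hr)]
      exact P.zero_mem
    · refine hPp.mem_of_pow_mem (N + 1) ?_
      have hpow : ∀ k, ∃ a : F.I (k * n),
          F.reesMonomial n ⟨(q : A[X]).coeff n, q.2 n⟩ ^ k = F.reesMonomial (k * n) a := by
        intro k
        induction k with
        | zero => exact ⟨⟨1, by rw [zero_mul, F.I_zero]; trivial⟩, Subtype.ext (by simp)⟩
        | succ k ih =>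
          obtain ⟨a, ha⟩ := ih
          rw [pow_succ, ha, reesMonomial_mul]
          exact ⟨⟨_, (Nat.succ_mul k n).symm ▸
            F.I_mul_le _ _ (Ideal.mul_mem_mul a.2 (q.2 n))⟩, Subtype.ext (by simp [Nat.succ_mul])⟩
      obtain ⟨a, ha⟩ := hpow (N + 1)
      rw [← map_pow, ha]
      exact hmon _ (by nlinarith) a
  have hp0 : IsUnit ((p : A[X]).coeff 0) := by
    by_contra hcon
    exact hu (hle ((fiberMk_mem_fiberMax hJm).2 ((IsLocalRing.mem_maximalIdeal _).2 hcon)))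
  have hxk : x ^ k ∈ J * F.I k := by
    have := hpk 0
    rw [zero_add] at this
    exact (Ideal.unit_mul_mem_iff_mem _ hp0).1 this
  refine hx.1.2 (eventually_atTop.2 ⟨N, fun n hn => ?_⟩)
  refine Submodule.eq_bot_of_le_smul_of_le_jacobson_bot J _ (IsNoetherian.noetherian _)
    (fun b hb => ?_) (hJm.trans (IsLocalRing.jacobson_eq_maximalIdeal ⊥ bot_ne_top).ge)
  refine hNk k n hn b hb ?_
  have h1 := Ideal.mul_mem_mul hxk hb
  rw [mul_assoc] at h1
  rw [add_comm]
  exact Ideal.mul_mono_right (F.I_mul_le k n) h1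

end Local

variable {B : Type u} [CommRing B]

/-- The homomorphism of Rees algebras induced by a ring homomorphism. -/
noncomputable def reesMap (F : IdealFiltration A) (f : A →+* B) : F.rees →+* (F.map f).rees :=
  ((Polynomial.mapRingHom f).comp F.rees.val.toRingHom).codRestrict (F.map f).rees fun p n => by
    change (Polynomial.map f (p : A[X])).coeff n ∈ _
    rw [Polynomial.coeff_map]
    exact Ideal.mem_map_of_mem f (p.2 n)

lemma coe_reesMap (f : A →+* B) (p : F.rees) :
    (F.reesMap f p : B[X]) = Polynomial.map f (p : A[X]) := rfl

lemma reesMap_surjective {f : A →+* B} (hf : Function.Surjective f) :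
    Function.Surjective (F.reesMap f) := by
  intro q
  have key : ∀ n, ∃ a : F.I n, f a = (q : B[X]).coeff n := fun n => by
    obtain ⟨a, ha, hae⟩ := (Ideal.mem_map_iff_of_surjective f hf).1 (q.2 n)
    exact ⟨⟨a, ha⟩, hae⟩
  choose a ha using key
  refine ⟨∑ n ∈ (q : B[X]).support, F.reesMonomial n (a n), ?_⟩
  conv_rhs => rw [(F.map f).eq_sum_reesMonomial q]
  rw [map_sum]
  refine Finset.sum_congr rfl fun n _ => Subtype.ext ?_
  rw [coe_reesMap, coe_reesMonomial, map_monomial, ha, coe_reesMonomial]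

/-- The homomorphism of fiber cones induced by a ring homomorphism. -/
noncomputable def fiberMap (F : IdealFiltration A) (J : Ideal A) (f : A →+* B) :
    F.fiberCone J →+* (F.map f).fiberCone (J.map f) :=
  Ideal.Quotient.lift _ (((F.map f).fiberMk (J.map f)).comp (F.reesMap f)) fun p hp => by
    rw [RingHom.comp_apply, fiberMk_eq_zero]
    intro n
    rw [coe_reesMap, Polynomial.coeff_map, map_I, ← Ideal.map_mul]
    exact Ideal.mem_map_of_mem f ((F.mem_map_algebraMap_rees).1 hp n)

lemma fiberMap_fiberMk (f : A →+* B) (p : F.rees) :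
    F.fiberMap J f (F.fiberMk J p) = (F.map f).fiberMk (J.map f) (F.reesMap f p) := rfl

lemma fiberMap_surjective {f : A →+* B} (hf : Function.Surjective f) :
    Function.Surjective (F.fiberMap J f) := by
  intro q
  obtain ⟨q, rfl⟩ := fiberMk_surjective _ _ q
  obtain ⟨p, rfl⟩ := reesMap_surjective hf q
  exact ⟨F.fiberMk J p, rfl⟩

lemma comap_fiberMap_fiberMax [IsLocalRing A] [IsLocalRing B]
    (hJ : J ≤ IsLocalRing.maximalIdeal A) {f : A →+* B} (hf : Function.Surjective f) :
    ((F.map f).fiberMax (J.map f)).comap (F.fiberMap J f) = F.fiberMax J := by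
  have : IsLocalHom f := IsLocalHom.of_surjective f hf
  have hJB : J.map f ≤ IsLocalRing.maximalIdeal B := by
    refine Ideal.map_le_iff_le_comap.2 (hJ.trans ?_)
    rw [IsLocalRing.maximalIdeal_comap]
  ext q
  obtain ⟨p, rfl⟩ := F.fiberMk_surjective J q
  rw [Ideal.mem_comap, fiberMap_fiberMk, fiberMk_mem_fiberMax hJB, fiberMk_mem_fiberMax hJ,
    coe_reesMap, Polynomial.coeff_map, ← Ideal.mem_comap, IsLocalRing.maximalIdeal_comap]

/-- Passing to a quotient in which a weak-(FC)-element vanishes lowers the height of the maximal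
homogeneous ideal of the fiber cone by at least one. -/
theorem IsWeakFCElement.height_fiberMax_add_one_le [IsNoetherianRing A] [IsLocalRing A]
    [IsLocalRing B] (hJ : J.radical = IsLocalRing.maximalIdeal A) {x : A}
    (hx : F.IsWeakFCElement J x) {f : A →+* B} (hf : Function.Surjective f) (hfx : f x = 0) :
    ((F.map f).fiberMax (J.map f)).height + 1 ≤ (F.fiberMax J).height := by
  have hJm : J ≤ IsLocalRing.maximalIdeal A := hJ ▸ Ideal.le_radical
  have : IsLocalHom f := IsLocalHom.of_surjective f hf
  have hJB : J.map f ≤ IsLocalRing.maximalIdeal B := by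
    refine Ideal.map_le_iff_le_comap.2 (hJm.trans ?_)
    rw [IsLocalRing.maximalIdeal_comap]
  have : IsNoetherianRing B := isNoetherianRing_of_surjective _ _ f hf
  obtain ⟨K, hK⟩ := hx.1.1.2
  have := (hK.map f).isNoetherianRing_fiberCone (J.map f)
  have hM := (fiberMax_isMaximal (F := F) hJm).isPrime
  have hMB := (fiberMax_isMaximal (F := F.map f) hJB).isPrime
  obtain ⟨l, hl, hlen⟩ := ((F.map f).fiberMax (J.map f)).exists_ltSeries_length_eq_height
  have hstrict : StrictMono (PrimeSpectrum.comap (F.fiberMap J f)) := by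
    intro P Q hPQ
    refine lt_of_le_of_ne (Ideal.comap_mono hPQ.le) fun h => hPQ.ne (PrimeSpectrum.ext ?_)
    exact Ideal.comap_injective_of_surjective _ (fiberMap_surjective hf)
      (congrArg PrimeSpectrum.asIdeal h)
  let l' := l.map _ hstrict
  have hlast : l'.last = ⟨F.fiberMax J, hM⟩ := by
    rw [LTSeries.last_map, hl]
    exact PrimeSpectrum.ext (comap_fiberMap_fiberMax hJm hf)
  obtain ⟨P, hP, hPle⟩ := Ideal.exists_minimalPrimes_le (bot_le (a := l'.head.asIdeal))
  have hPne : P ≠ l'.head.asIdeal := by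
    rintro rfl
    refine hx.notMem_minimalPrimes hJ ?_ hP
    rw [LTSeries.head_map, PrimeSpectrum.comap_asIdeal, Ideal.mem_comap, fiberMap_fiberMk]
    convert Ideal.zero_mem _
    rw [show F.reesMap f (F.reesMonomial 1 ⟨x, hx.2.1⟩) = 0 from
      Subtype.ext (by simp [coe_reesMap, hfx]), map_zero]
  have hlt : (⟨P, hP.isPrime⟩ : PrimeSpectrum (F.fiberCone J)) < l'.head :=
    lt_of_le_of_ne hPle fun h => hPne (congrArg PrimeSpectrum.asIdeal h)
  have h1 := Order.length_le_height_last (p := l'.cons _ hlt)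
  rw [RelSeries.last_cons, hlast, RelSeries.cons_length] at h1
  rw [← hlen]
  have h2 := PrimeSpectrum.height_eq_orderHeight (⟨F.fiberMax J, hM⟩ : PrimeSpectrum _)
  rw [← h2] at h1
  exact_mod_cast h1

end IdealFiltration

/-! ### Chains of weak-(FC)-elements -/

namespace IsLocalRing

variable {A B : Type*} [CommRing A] [CommRing B] [IsLocalRing A] [IsLocalRing B]

lemma radical_map_of_surjective {f : A →+* B} (hf : Function.Surjective f) {J : Ideal A}
    (hJ : J.radical = maximalIdeal A) : (J.map f).radical = maximalIdeal B := by
  have : IsLocalHom f := IsLocalHom.of_surjective f hf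
  apply le_antisymm
  · refine (maximalIdeal.isMaximal B).isPrime.radical_le_iff.2 (Ideal.map_le_iff_le_comap.2 ?_)
    rw [maximalIdeal_comap, ← hJ]
    exact Ideal.le_radical
  · rw [← Ideal.map_comap_of_surjective f hf (maximalIdeal B), maximalIdeal_comap, ← hJ]
    exact Ideal.map_radical_le f

lemma infinite_residueField_of_surjective [Infinite (ResidueField A)] {f : A →+* B}
    (hf : Function.Surjective f) : Infinite (ResidueField B) := by
  have : IsLocalHom f := IsLocalHom.of_surjective f hf
  exact Infinite.of_injective _ (ResidueField.map f).injective

end IsLocalRing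

namespace IdealFiltration

section Image

variable {A B : Type u} [CommRing A] [CommRing B] {F : IdealFiltration A} {J : Ideal A}

lemma map_I_one_ne_top {f : A →+* B} (hf : Function.Surjective f) (h₁ : F.I 1 ≠ ⊤)
    (hker : RingHom.ker f ≤ F.I 1) : (F.map f).I 1 ≠ ⊤ := by
  intro h
  have h2 := Ideal.comap_map_of_surjective' f hf (F.I 1)
  rw [← map_I, h, Ideal.comap_top, sup_eq_left.2 hker] at h2
  exact h₁ h2.symm

lemma IsGood.map (h : F.IsGood) {f : A →+* B} (hf : Function.Surjective f)
    (hker : RingHom.ker f ≤ F.I 1) : (F.map f).IsGood := by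
  obtain ⟨h₁, K, hK⟩ := h
  exact ⟨map_I_one_ne_top hf h₁ hker, K.map f, hK.map f⟩

lemma IsGood.quotient (h : F.IsGood) {N : Ideal A} (hN : N ≤ F.I 1) : (F.quotient N).IsGood :=
  h.map Ideal.Quotient.mk_surjective (by rwa [Ideal.mk_ker])

lemma IsGood.nontrivial_quotient (h : F.IsGood) {N : Ideal A} (hN : N ≤ F.I 1) :
    Nontrivial (A ⧸ N) :=
  Ideal.Quotient.nontrivial_iff.2 fun h' => h.1 (top_le_iff.1 (h' ▸ hN))

lemma isNilpotent_map {f : A →+* B} :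
    (F.map f).IsNilpotent ↔ ∀ᶠ n in atTop, F.I n ≤ RingHom.ker f :=
  eventually_congr (Eventually.of_forall fun n => by rw [map_I, Ideal.map_eq_bot_iff_le_ker])

lemma IsFilterRegular.map_equiv {K : Ideal A} {x : A} (h : IsFilterRegular K x) (e : A ≃+* B) :
    IsFilterRegular (K.map (e : A →+* B)) (e x) := by
  intro a ha
  obtain ⟨n, hn⟩ := h (e.symm a) (e.injective (by simpa using ha))
  refine ⟨n, fun b hb => ?_⟩
  rw [← Ideal.map_pow] at hb
  obtain ⟨c, hc, rfl⟩ := (Ideal.mem_map_iff_of_surjective _ e.surjective).1 hb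
  have := congrArg e (hn c hc)
  simpa using this

lemma IsWeakFCElement.map_equiv {x : A} (h : F.IsWeakFCElement J x) (e : A ≃+* B) :
    (F.map (e : A →+* B)).IsWeakFCElement (J.map (e : A →+* B)) (e x) := by
  have hker : RingHom.ker (e : A →+* B) = ⊥ := (RingHom.injective_iff_ker_eq_bot _).1 e.injective
  have hinf : ∀ I J : Ideal A, (I ⊓ J).map (e : A →+* B) =
      I.map (e : A →+* B) ⊓ J.map (e : A →+* B) := by
    intro I J
    have h1 : ∀ I : Ideal A, I.map (e : A →+* B) = I.comap (e.symm : B →+* A) :=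
      fun I => Ideal.map_comap_of_equiv e
    rw [h1, h1, h1]; rfl
  obtain ⟨⟨hgood, hnil⟩, hx1, hFC, hreg⟩ := h
  refine ⟨⟨hgood.map e.surjective (hker ▸ bot_le), ?_⟩, Ideal.mem_map_of_mem _ hx1, ?_,
    hreg.map_equiv e⟩
  · rw [isNilpotent_map, hker]
    exact fun h => hnil (h.mono fun n hn => le_bot_iff.1 hn)
  · filter_upwards [hFC] with n hn m
    have := congrArg (Ideal.map (e : A →+* B)) (hn m)
    rw [hinf, Ideal.map_mul, Ideal.map_mul, Ideal.map_mul, Ideal.map_pow, Ideal.map_span,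
      Set.image_singleton] at this
    exact this

lemma map_map {C : Type u} [CommRing C] (f : A →+* B) (g : B →+* C) :
    (F.map f).map g = F.map (g.comp f) := by
  simp only [map, Ideal.map_map]

/-- Whether the image of `x` is a weak-(FC)-element of the image of `F` under a surjection `f`
depends on the kernel of `f` only. -/
lemma IsWeakFCElement.of_ker_eq {C : Type u} [CommRing C] {f : A →+* B} {g : A →+* C}
    (hf : Function.Surjective f) (hg : Function.Surjective g)
    (hker : RingHom.ker f = RingHom.ker g) {x : A}
    (h : (F.map f).IsWeakFCElement (J.map f) (f x)) :
    (F.map g).IsWeakFCElement (J.map g) (g x) := by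
  let e : B ≃+* C := (RingHom.quotientKerEquivOfSurjective hf).symm.trans
    ((Ideal.quotEquivOfEq hker).trans (RingHom.quotientKerEquivOfSurjective hg))
  have he : ∀ a, e (f a) = g a := by
    intro a
    have : (RingHom.quotientKerEquivOfSurjective hf).symm (f a) = Ideal.Quotient.mk _ a := by
      rw [RingEquiv.symm_apply_eq]; rfl
    simp only [e, RingEquiv.trans_apply, this]
    rfl
  have hcomp : (e : B →+* C).comp f = g := RingHom.ext he
  have h1 := h.map_equiv e
  rwa [map_map, Ideal.map_map, hcomp, he] at h1

end Image

/-- `FCChain F J [x_1, …, x_s]`: the element `x_1` is a weak-(FC)-element for `(J, F)`, the image of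
`x_2` is one for the image of `(J, F)` in `A / (x_1)`, the image of `x_3` for that in
`(A / (x_1)) / (x_2)`, and so on; and the last filtration is nilpotent. In contrast to
`IsMaximalWeakFCSequence`, the quotients are iterated ones, which suits inductive proofs. -/
inductive FCChain : ∀ {A : Type u} [CommRing A], IdealFiltration A → Ideal A → List A → Prop
  | nil {A : Type u} [CommRing A] {F : IdealFiltration A} {J : Ideal A} (h : F.IsNilpotent) :
      FCChain F J []
  | cons {A : Type u} [CommRing A] {F : IdealFiltration A} {J : Ideal A} {x : A} {xs : List A}
      (hx : F.IsWeakFCElement J x)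
      (h : FCChain (F.quotient (Ideal.span {x})) (J.map (Ideal.Quotient.mk (Ideal.span {x})))
        (xs.map (Ideal.Quotient.mk (Ideal.span {x})))) :
      FCChain F J (x :: xs)

variable {A : Type u} [CommRing A] {F : IdealFiltration A} {J : Ideal A}

lemma IsWeakFCElement.span_le {x : A} (h : F.IsWeakFCElement J x) :
    Ideal.span {x} ≤ F.I 1 := by
  simpa using h.2.1

/-- A chain of weak-(FC)-elements that ends in a nilpotent filtration generates a reduction. -/
theorem FCChain.isReduction {xs : List A} (h : FCChain F J xs) :
    F.IsReduction (Ideal.ofList xs) := by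
  induction h with
  | nil h =>
    refine ⟨fun n => by simp, ?_⟩
    filter_upwards [(tendsto_add_atTop_nat 1).eventually h] with n hn
    simpa using hn
  | @cons A _ F J x xs hx _ ih =>
    rw [← Ideal.map_ofList] at ih
    have hle : Ideal.ofList xs ≤ F.I 1 := by
      have h1 := Ideal.map_le_iff_le_comap.1 (IsGoodFor.le_one ih)
      rw [quotient_I, Ideal.comap_map_of_surjective' _ Ideal.Quotient.mk_surjective,
        Ideal.mk_ker, sup_eq_left.2 hx.span_le] at h1
      exact h1
    have hle' : Ideal.ofList (x :: xs) ≤ F.I 1 := by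
      rw [Ideal.ofList_cons]; exact sup_le hx.span_le hle
    have hmul : ∀ n, Ideal.ofList (x :: xs) * F.I n ≤ F.I (n + 1) := fun n => by
      rw [add_comm]; exact (Ideal.mul_mono_left hle').trans (F.I_mul_le 1 n)
    refine ⟨hmul, ?_⟩
    filter_upwards [ih.2, hx.2.2.1] with n hn hFC
    refine le_antisymm (fun a ha => ?_) (hmul n)
    have h1 : F.I (n + 1) ≤ Ideal.ofList xs * F.I n ⊔ Ideal.span {x} := by
      rw [quotient_I, quotient_I, ← Ideal.map_mul] at hn
      have := Ideal.map_le_iff_le_comap.1 hn.le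
      rwa [Ideal.comap_map_of_surjective' _ Ideal.Quotient.mk_surjective, Ideal.mk_ker] at this
    obtain ⟨b, hb, c, hc, rfl⟩ := Submodule.mem_sup.1 (h1 ha)
    have hmul' : Ideal.ofList xs * F.I n ≤ Ideal.ofList (x :: xs) * F.I n :=
      Ideal.mul_mono_left (by rw [Ideal.ofList_cons]; exact le_sup_right)
    have hb' := hmul' hb
    refine Ideal.add_mem _ hb' ?_
    have hc' : c ∈ J ^ 0 * F.I (n + 1) ⊓ Ideal.span {x} :=
      ⟨by simpa using (Ideal.add_mem_iff_right _ (hmul n hb')).1 ha, hc⟩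
    rw [hFC 0, pow_zero, Ideal.one_eq_top, Ideal.top_mul] at hc'
    have hmul'' : Ideal.span {x} * F.I n ≤ Ideal.ofList (x :: xs) * F.I n :=
      Ideal.mul_mono_left (by rw [Ideal.ofList_cons]; exact le_sup_left)
    exact hmul'' hc'

theorem FCChain.length_le_height {xs : List A} (h : FCChain F J xs) :
    ∀ [IsNoetherianRing A] [IsLocalRing A], J.radical = IsLocalRing.maximalIdeal A →
      (xs.length : ℕ∞) ≤ (F.fiberMax J).height := by
  induction h with
  | nil h => intros; simp
  | @cons A _ F J x xs hx _ ih =>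
    intro _ _ hJ
    have := hx.1.1.nontrivial_quotient hx.span_le
    have hloc : IsLocalRing (A ⧸ Ideal.span {x}) :=
      IsLocalRing.of_surjective' (Ideal.Quotient.mk _) Ideal.Quotient.mk_surjective
    have h1 := ih (IsLocalRing.radical_map_of_surjective Ideal.Quotient.mk_surjective hJ)
    have h2 := hx.height_fiberMax_add_one_le hJ (f := Ideal.Quotient.mk (Ideal.span {x}))
      Ideal.Quotient.mk_surjective (Ideal.Quotient.eq_zero_iff_mem.2
        (Ideal.mem_span_singleton_self x))
    rw [List.length_map] at h1
    rw [List.length_cons, Nat.cast_add, Nat.cast_one]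
    exact (add_le_add_left h1 1).trans h2

lemma span_range_get (xs : List A) : Ideal.span (Set.range xs.get) = Ideal.ofList xs :=
  congrArg Ideal.span (Set.range_list_get xs)

theorem FCChain.ringKrullDim_fiberCone {xs : List A} (h : FCChain F J xs) [IsNoetherianRing A]
    [IsLocalRing A] (hJ : J.radical = IsLocalRing.maximalIdeal A) :
    ringKrullDim (F.fiberCone J) = xs.length ∧ (F.fiberMax J).height = xs.length := by
  have h1 : ringKrullDim (F.fiberCone J) ≤ xs.length :=
    IsGoodFor.ringKrullDim_fiberCone_le hJ (x := xs.get)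
      (by rw [span_range_get]; exact h.isReduction)
  have h2 := h.length_le_height hJ
  have := (fiberMax_isMaximal (F := F) (J := J) (hJ ▸ Ideal.le_radical)).isPrime
  have h3 := (F.fiberMax J).height_le_ringKrullDim_of_isPrime
  refine ⟨le_antisymm h1 (le_trans ?_ h3), le_antisymm ?_ h2⟩
  · exact_mod_cast h2
  · exact_mod_cast h3.trans h1

/-- The dimension of the fiber cone is the same for all `𝔪`-primary ideals `J`. -/
lemma ringKrullDim_fiberCone_congr [IsLocalRing A] (F : IdealFiltration A) {J J' : Ideal A}
    (h : J.radical = J'.radical) :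
    ringKrullDim (F.fiberCone J) = ringKrullDim (F.fiberCone J') := by
  have hz : PrimeSpectrum.zeroLocus (J.map (algebraMap A F.rees) : Set F.rees) =
      PrimeSpectrum.zeroLocus (J'.map (algebraMap A F.rees)) := by
    ext P
    have key : ∀ J : Ideal A, P ∈ PrimeSpectrum.zeroLocus (J.map (algebraMap A F.rees) : Set F.rees)
        ↔ J.radical ≤ P.asIdeal.comap (algebraMap A F.rees) := fun J => by
      rw [PrimeSpectrum.mem_zeroLocus, SetLike.coe_subset_coe, Ideal.map_le_iff_le_comap,
        (P.isPrime.comap _).radical_le_iff]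
    rw [key, key, h]
  have hdim : ∀ J : Ideal A, ringKrullDim (F.fiberCone J) = Order.krullDim
      (PrimeSpectrum.zeroLocus (J.map (algebraMap A F.rees) : Set F.rees)) :=
    fun J => ringKrullDim_quotient _
  rw [hdim, hdim, hz]

theorem FCChain.analyticSpread {xs : List A} (h : FCChain F J xs) [IsNoetherianRing A]
    [IsLocalRing A] (hJ : J.radical = IsLocalRing.maximalIdeal A) :
    F.analyticSpread = xs.length := by
  rw [← (h.ringKrullDim_fiberCone hJ).1]
  refine ringKrullDim_fiberCone_congr F ?_
  rw [hJ, (IsLocalRing.maximalIdeal.isMaximal A).isPrime.radical]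

/-! ### Weak-(FC)-sequences -/

lemma initIdeal_succ (xs : List A) {i : ℕ} (hi : i < xs.length) :
    initIdeal xs (i + 1) = Ideal.span {xs[i]} ⊔ initIdeal xs i := by
  rw [initIdeal, List.take_add_one, List.getElem?_eq_getElem hi, Option.toList_some,
    Ideal.ofList_append, Ideal.ofList_singleton, sup_comm]

lemma IsMaximalWeakFCSequence.fcChain_map {xs : List A} (h : F.IsMaximalWeakFCSequence J xs)
    (k : ℕ) : ∀ i, i + k = xs.length → ∀ {B : Type u} [CommRing B] {f : A →+* B},
      Function.Surjective f → RingHom.ker f = initIdeal xs i →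
      FCChain (F.map f) (J.map f) ((xs.drop i).map f) := by
  induction k with
  | zero =>
    intro i hi B _ f hf hker
    obtain rfl : i = xs.length := by omega
    rw [List.drop_length, List.map_nil]
    refine FCChain.nil ?_
    have h1 := isNilpotent_map.1 (show (F.map (Ideal.Quotient.mk _)).IsNilpotent from h.2.2)
    rw [isNilpotent_map, hker]
    simpa only [Ideal.mk_ker] using h1
  | succ k ih =>
    intro i hi B _ f hf hker
    have hi' : i < xs.length := by omega
    rw [List.drop_eq_getElem_cons hi', List.map_cons]
    refine FCChain.cons ((h.1.2 i hi').of_ker_eq (F := F) Ideal.Quotient.mk_surjective hf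
      (by rw [Ideal.mk_ker, hker])) ?_
    have h1 := ih (i + 1) (by omega) (f := (Ideal.Quotient.mk (Ideal.span {f xs[i]})).comp f)
      (Ideal.Quotient.mk_surjective.comp hf) (by
        rw [initIdeal_succ xs hi', ← hker, ← RingHom.comap_ker, Ideal.mk_ker,
          ← Set.image_singleton, ← Ideal.map_span, Ideal.comap_map_of_surjective' f hf])
    rw [← map_map, ← Ideal.map_map] at h1
    rw [List.map_map]
    exact h1

lemma map_id : F.map (RingHom.id A) = F := by
  simp only [map, Ideal.map_id]

lemma IsMaximalWeakFCSequence.fcChain {xs : List A} (h : F.IsMaximalWeakFCSequence J xs) :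
    FCChain F J xs := by
  have := h.fcChain_map xs.length 0 (zero_add _) (f := RingHom.id A) Function.surjective_id
    (by rw [(RingHom.injective_iff_ker_eq_bot _).1 Function.injective_id]; simp [initIdeal])
  simpa [map_id, Ideal.map_id] using this

lemma IsWeakFCElement.ne_zero {K : Ideal A} {x : A} (h : F.IsWeakFCElement K x) : x ≠ 0 := by
  rintro rfl
  obtain ⟨⟨⟨-, L, hL⟩, hnil⟩, -, -, hreg⟩ := h
  -- `0` is filter-regular only if some power of `I_1` vanishes
  obtain ⟨n, hn⟩ := hreg 1 (by simp)
  obtain ⟨c, hc⟩ := hL.exists_le_pow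
  refine hnil (eventually_atTop.2 ⟨c + n, fun m hm => eq_bot_iff.2 fun b hb => ?_⟩)
  have h1 := hc n (F.antitone hm hb)
  simpa using hn b (Ideal.pow_right_mono hL.le_one n h1)

lemma IsWeakFCSequence.append_singleton {xs : List A} {x : A} (h : F.IsWeakFCSequence J xs)
    (hx₁ : x ∈ F.I 1) (hx : (F.quotient (Ideal.ofList xs)).IsWeakFCElement
      (J.map (Ideal.Quotient.mk (Ideal.ofList xs))) (Ideal.Quotient.mk (Ideal.ofList xs) x)) :
    F.IsWeakFCSequence J (xs ++ [x]) := by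
  have key : ∀ {N N' : Ideal A} {y y' : A}, N = N' → y = y' →
      (F.quotient N).IsWeakFCElement (J.map (Ideal.Quotient.mk N)) (Ideal.Quotient.mk N y) →
      (F.quotient N').IsWeakFCElement (J.map (Ideal.Quotient.mk N'))
        (Ideal.Quotient.mk N' y') := by
    rintro N _ y _ rfl rfl h
    exact h
  refine ⟨fun y hy => ?_, fun i hi => ?_⟩
  · rcases List.mem_append.1 hy with hy | hy
    · exact h.1 y hy
    · rw [List.mem_singleton.1 hy]; exact hx₁
  · rw [List.length_append, List.length_singleton] at hi
    rcases Nat.lt_or_ge i xs.length with hi' | hi'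
    · refine key ?_ ?_ (h.2 i hi')
      · rw [initIdeal, initIdeal, List.take_append_of_le_length hi'.le]
      · rw [List.getElem_append_left hi']
    · obtain rfl : i = xs.length := by omega
      refine key ?_ ?_ hx
      · rw [initIdeal, List.take_left']
        rfl
      · simp

/-- Weak-(FC)-sequences in a reduction `K` can be extended to maximal ones in `K`. -/
theorem IsWeakFCSequence.exists_isMaximalWeakFCSequence [IsNoetherianRing A] [IsLocalRing A]
    [Infinite (IsLocalRing.ResidueField A)] (h₁ : F.I 1 ≠ ⊤) {K : Ideal A}
    (hK : F.IsReduction K) {xs : List A} (h : F.IsWeakFCSequence J xs) (hxs : ∀ x ∈ xs, x ∈ K) :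
    ∃ ys, F.IsMaximalWeakFCSequence J (xs ++ ys) ∧ ∀ x ∈ xs ++ ys, x ∈ K := by
  -- the ideals generated by longer and longer sequences increase strictly
  induction hN : Ideal.ofList xs using WellFoundedGT.induction generalizing xs with
  | ind N ih =>
  by_cases hnil : (F.quotient (Ideal.ofList xs)).IsNilpotent
  · refine ⟨[], ⟨?_, ?_, ?_⟩, ?_⟩
    · rwa [List.append_nil]
    · intro i hi
      rw [List.append_nil] at hi ⊢
      exact (h.2 i (by omega)).1.2
    · rw [List.append_nil, initIdeal, List.take_length]
      exact hnil
    · rwa [List.append_nil]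
  · have hle : Ideal.ofList xs ≤ F.I 1 := Ideal.span_le.2 fun x hx => h.1 x hx
    have hgood : F.IsGood := ⟨h₁, K, hK⟩
    have := hgood.nontrivial_quotient hle
    have hloc : IsLocalRing (A ⧸ Ideal.ofList xs) :=
      IsLocalRing.of_surjective' (Ideal.Quotient.mk _) Ideal.Quotient.mk_surjective
    have hinf : Infinite (IsLocalRing.ResidueField (A ⧸ Ideal.ofList xs)) :=
      IsLocalRing.infinite_residueField_of_surjective
        (f := Ideal.Quotient.mk (Ideal.ofList xs)) Ideal.Quotient.mk_surjective
    obtain ⟨x', hx'K, hx'⟩ := IsGoodFor.exists_isWeakFCElement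
      (F := F.quotient (Ideal.ofList xs)) (IsGoodFor.map hK (Ideal.Quotient.mk _))
      (hgood.quotient hle).1 hnil (J.map (Ideal.Quotient.mk (Ideal.ofList xs)))
    obtain ⟨x, hxK, rfl⟩ := (Ideal.mem_map_iff_of_surjective _ Ideal.Quotient.mk_surjective).1 hx'K
    have hlt : N < Ideal.ofList (xs ++ [x]) := by
      rw [Ideal.ofList_append, ← hN]
      refine lt_of_le_of_ne le_sup_left fun heq => hx'.ne_zero ?_
      rw [Ideal.Quotient.eq_zero_iff_mem, heq]
      rw [Ideal.ofList_singleton]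
      exact Ideal.mem_sup_right (Ideal.mem_span_singleton_self x)
    obtain ⟨ys, hys, hysK⟩ := ih _ hlt (h.append_singleton (IsGoodFor.le_one hK hxK) hx')
      (by
        intro y hy
        rcases List.mem_append.1 hy with hy | hy
        · exact hxs y hy
        · rw [List.mem_singleton.1 hy]; exact hxK) rfl
    rw [List.append_assoc] at hys hysK
    exact ⟨_, hys, hysK⟩

lemma isWeakFCSequence_nil : F.IsWeakFCSequence J [] :=
  ⟨fun _ hx => absurd hx List.not_mem_nil, fun i hi => absurd hi (Nat.not_lt_zero i)⟩

lemma IsWeakFCElement.isWeakFCSequence_singleton {x : A} (h : F.IsWeakFCElement J x) :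
    F.IsWeakFCSequence J [x] := by
  refine isWeakFCSequence_nil.append_singleton h.2.1 ?_
  refine IsWeakFCElement.of_ker_eq (f := RingHom.id A) (F := F) Function.surjective_id
    Ideal.Quotient.mk_surjective ?_ ?_
  · rw [(RingHom.injective_iff_ker_eq_bot _).1 Function.injective_id, Ideal.mk_ker,
      Ideal.ofList_nil]
  · rwa [map_id, Ideal.map_id]

/-! ### Minimality of reductions -/

/-- A reduction properly contained in a reduction with `s` generators contains a reduction with
fewer than `s` generators: it is proper modulo `𝔪`. -/
lemma IsGoodFor.exists_span_range_of_lt [IsNoetherianRing A] [IsLocalRing A] {s : ℕ} {x : Fin s → A}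
    (hK : F.IsGoodFor (Ideal.span (Set.range x))) {L : Ideal A} (hL : F.IsGoodFor L)
    (hlt : L < Ideal.span (Set.range x)) :
    ∃ r < s, ∃ z : Fin r → A, F.IsGoodFor (Ideal.span (Set.range z)) := by
  set K := Ideal.span (Set.range x) with hKdef
  let ψ : (Fin s → A) →ₗ[A] A := Fintype.linearCombination A x
  have hψK : ∀ a ∈ K, ∃ v, ψ v = a := by
    intro a ha
    have : LinearMap.range ψ = K := Fintype.range_linearCombination A x
    rw [← this] at ha
    exact ha
  let ρ : (Fin s → A) → (Fin s → IsLocalRing.ResidueField A) :=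
    fun v i => IsLocalRing.residue A (v i)
  have hρsurj : Function.Surjective (IsLocalRing.residue A) := IsLocalRing.residue_surjective
  let S : Set (Fin s → IsLocalRing.ResidueField A) := ρ '' {v | ψ v ∈ L}
  obtain ⟨b, hbS, hbspan, -⟩ := Submodule.exists_fun_fin_finrank_span_eq
    (IsLocalRing.ResidueField A) S
  choose v hv hvb using hbS
  let z := fun j => ψ (v j)
  have hzL : Ideal.span (Set.range z) ≤ L := by
    rw [Ideal.span_le]
    rintro _ ⟨j, rfl⟩
    exact hv j
  have hker : ∀ w, ρ w ∈ Submodule.span (IsLocalRing.ResidueField A) S →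
      ψ w ∈ Ideal.span (Set.range z) ⊔ IsLocalRing.maximalIdeal A * K := by
    intro w hw
    rw [← hbspan, Submodule.mem_span_range_iff_exists_fun] at hw
    obtain ⟨c, hc⟩ := hw
    choose a ha using fun j => hρsurj (c j)
    have hdiff : ∀ i, w i - ∑ j, a j * v j i ∈ IsLocalRing.maximalIdeal A := by
      intro i
      rw [← IsLocalRing.residue_eq_zero_iff, map_sub, sub_eq_zero, map_sum]
      have := congrFun hc i
      rw [Finset.sum_apply] at this
      rw [show IsLocalRing.residue A (w i) = ρ w i from rfl, ← this]
      refine Finset.sum_congr rfl fun j _ => ?_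
      rw [map_mul, ha, Pi.smul_apply, smul_eq_mul, ← hvb j]
    have hsplit : ψ w = ∑ j, a j * z j + ∑ i, (w i - ∑ j, a j * v j i) * x i := by
      simp only [ψ, z, Fintype.linearCombination_apply, smul_eq_mul, sub_mul,
        Finset.sum_sub_distrib, Finset.sum_mul, Finset.mul_sum]
      rw [Finset.sum_comm (γ := Fin s)]
      simp [mul_assoc]
    rw [hsplit]
    refine Submodule.add_mem_sup (Ideal.sum_mem _ fun j _ => Ideal.mul_mem_left _ _
      (Ideal.subset_span ⟨j, rfl⟩)) (Ideal.sum_mem _ fun i _ => Ideal.mul_mem_mul (hdiff i)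
      (Ideal.subset_span ⟨i, rfl⟩))
  have hjac : IsLocalRing.maximalIdeal A ≤ Ideal.jacobson ⊥ :=
    (IsLocalRing.jacobson_eq_maximalIdeal ⊥ bot_ne_top).ge
  refine ⟨_, ?_, z, ?_⟩
  · -- otherwise `K ⊆ L + 𝔪 K`
    have hne : Submodule.span (IsLocalRing.ResidueField A) S ≠ ⊤ := by
      intro htop
      refine hlt.not_ge ?_
      refine Submodule.le_of_le_smul_of_le_jacobson_bot (IsNoetherian.noetherian _) hjac ?_
      intro a ha
      obtain ⟨w, rfl⟩ := hψK a ha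
      exact sup_le_sup_right hzL _ (hker w (htop ▸ Submodule.mem_top))
    simpa using Submodule.finrank_lt hne
  · have hmul : ∀ n, Ideal.span (Set.range z) * F.I n ≤ F.I (n + 1) :=
      fun n => (Ideal.mul_mono_left hzL).trans (hL.1 n)
    refine ⟨hmul, ?_⟩
    filter_upwards [hL.2] with n hn
    refine le_antisymm ?_ (hmul n)
    refine Submodule.le_of_le_smul_of_le_jacobson_bot (IsNoetherian.noetherian _) hjac ?_
    have hLle : L ≤ Ideal.span (Set.range z) ⊔ IsLocalRing.maximalIdeal A * K := by
      intro a ha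
      obtain ⟨w, rfl⟩ := hψK a (hlt.le ha)
      exact hker w (Submodule.subset_span ⟨w, ha, rfl⟩)
    calc F.I (n + 1) = L * F.I n := hn
      _ ≤ (Ideal.span (Set.range z) ⊔ IsLocalRing.maximalIdeal A * K) * F.I n :=
        Ideal.mul_mono_left hLle
      _ = Ideal.span (Set.range z) * F.I n ⊔ IsLocalRing.maximalIdeal A * (K * F.I n) := by
        rw [Ideal.sup_mul, mul_assoc]
      _ ≤ _ := sup_le_sup_left (Ideal.mul_mono_right (hK.1 n)) _

/-- A reduction with `ℓ(F)` generators is minimal. -/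
theorem IsReduction.isMinimalReduction [IsNoetherianRing A] [IsLocalRing A] {xs : List A}
    (h : F.IsReduction (Ideal.ofList xs)) (hℓ : F.analyticSpread = xs.length) :
    F.IsMinimalReduction (Ideal.ofList xs) := by
  refine ⟨h, fun L hL hle => ?_⟩
  by_contra hne
  have hK : F.IsGoodFor (Ideal.span (Set.range xs.get)) := by
    rw [span_range_get]; exact h
  obtain ⟨r, hr, z, hz⟩ := hK.exists_span_range_of_lt hL
    (by rw [span_range_get]; exact lt_of_le_of_ne hle hne)
  have h1 : F.analyticSpread ≤ r := hz.ringKrullDim_fiberCone_le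
    (IsLocalRing.maximalIdeal.isMaximal A).isPrime.radical
  rw [hℓ] at h1
  have h2 : xs.length ≤ r := by exact_mod_cast h1
  omega

end IdealFiltration

/-! ### Growth of sequences -/

lemma tendsto_natCast_add_div_natCast_add (k r : ℕ) :
    Tendsto (fun n : ℕ => ((n + k : ℕ) : ℝ) / ((n + r : ℕ) : ℝ)) atTop (𝓝 1) := by
  have h1 : Tendsto (fun n : ℕ => ((k : ℝ) - r) / ((n + r : ℕ) : ℝ)) atTop (𝓝 0) :=
    ((tendsto_const_div_atTop_nhds_zero_nat ((k : ℝ) - r)).comp (tendsto_add_atTop_nat r))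
  have h2 := h1.const_add 1
  rw [add_zero] at h2
  refine h2.congr' ?_
  filter_upwards [eventually_gt_atTop 0] with n hn
  have : ((n + r : ℕ) : ℝ) ≠ 0 := by positivity
  field_simp
  push_cast
  ring

lemma tendsto_add_div_add_pow {u : ℕ → ℝ} {d : ℕ} {e : ℝ}
    (h : Tendsto (fun n : ℕ => u n / (n : ℝ) ^ d) atTop (𝓝 e)) (k r : ℕ) :
    Tendsto (fun n : ℕ => u (n + k) / ((n + r : ℕ) : ℝ) ^ d) atTop (𝓝 e) := by
  have h1 := (h.comp (tendsto_add_atTop_nat k)).mul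
    ((tendsto_natCast_add_div_natCast_add k r).pow d)
  rw [one_pow, mul_one] at h1
  refine h1.congr' ?_
  filter_upwards [eventually_gt_atTop 0] with n hn
  have : ((n + r : ℕ) : ℝ) ≠ 0 := by positivity
  have : ((n + k : ℕ) : ℝ) ≠ 0 := by positivity
  rw [Function.comp_apply, div_pow]
  field_simp

lemma tendsto_succ_pow_sub_pow_div (d : ℕ) :
    Tendsto (fun n : ℕ => (((n + 1 : ℕ) : ℝ) ^ (d + 1) - (n : ℝ) ^ (d + 1)) / (n : ℝ) ^ d) atTop
      (𝓝 (d + 1)) := by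
  have h1 : Tendsto
      (fun n : ℕ => ∑ i ∈ Finset.range (d + 1), (((n + 1 : ℕ) : ℝ) / (n + 0 : ℕ)) ^ i) atTop
      (𝓝 (∑ i ∈ Finset.range (d + 1), (1 : ℝ) ^ i)) :=
    tendsto_finsetSum _ fun i _ => (tendsto_natCast_add_div_natCast_add 1 0).pow i
  have h2 : (∑ i ∈ Finset.range (d + 1), (1 : ℝ) ^ i) = d + 1 := by simp
  rw [h2] at h1
  refine h1.congr' ?_
  filter_upwards [eventually_gt_atTop 0] with n hn
  have hn' : (n : ℝ) ≠ 0 := by positivity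
  have h3 := (Commute.all (((n + 1 : ℕ) : ℝ)) (n : ℝ)).mul_geom_sum₂ (d + 1)
  rw [show ((n + 1 : ℕ) : ℝ) - n = 1 by push_cast; ring, one_mul] at h3
  rw [← h3, Finset.sum_div]
  refine Finset.sum_congr rfl fun i hi => ?_
  have hi' : i ≤ d := by simpa [Nat.lt_succ_iff] using hi
  rw [add_zero, div_pow, show d + 1 - 1 - i = d - i by omega, div_eq_div_iff (by positivity)
    (by positivity), mul_assoc, ← pow_add, Nat.sub_add_cancel hi']

/-- If `a_n / n^d` converges to `e`, then `(a_0 + ⋯ + a_{n-1}) / n^(d+1)` converges to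
`e / (d + 1)`. -/
lemma tendsto_sum_range_div_pow {a : ℕ → ℝ} {d : ℕ} {e : ℝ}
    (h : Tendsto (fun n : ℕ => a n / (n : ℝ) ^ d) atTop (𝓝 e)) :
    Tendsto (fun n : ℕ => (∑ i ∈ Finset.range n, a i) / (n : ℝ) ^ (d + 1)) atTop
      (𝓝 (e / (d + 1))) := by
  -- compare `a_n` with the differences of `n^(d+1)`
  let g : ℕ → ℝ := fun n => ((n + 1 : ℕ) : ℝ) ^ (d + 1) - (n : ℝ) ^ (d + 1)
  have hgsum : ∀ n, ∑ i ∈ Finset.range n, g i = (n : ℝ) ^ (d + 1) := fun n => by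
    rw [Finset.sum_range_sub (fun n : ℕ => (n : ℝ) ^ (d + 1))]; simp
  have hd : (d + 1 : ℝ) ≠ 0 := by positivity
  have hlittle : (fun n => a n - e / (d + 1) * g n) =o[atTop] g := by
    rw [Asymptotics.isLittleO_iff_tendsto']
    · have h1 := (h.div (tendsto_succ_pow_sub_pow_div d) hd).sub_const (e / (d + 1))
      rw [sub_self] at h1
      refine h1.congr' ?_
      filter_upwards [eventually_gt_atTop 0] with n hn
      have hn' : (n : ℝ) ≠ 0 := by positivity
      have hg : g n ≠ 0 := by
        refine (sub_pos.2 (pow_lt_pow_left₀ ?_ (by positivity) (by omega))).ne'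
        push_cast; linarith
      change a n / n ^ d / (g n / n ^ d) - _ = _
      field_simp
    · refine Eventually.of_forall fun n hn => ?_
      refine absurd hn (sub_pos.2 (pow_lt_pow_left₀ ?_ (by positivity) (by omega))).ne'
      push_cast; linarith
  have hsum := hlittle.sum_range (fun n => sub_nonneg.2 (pow_le_pow_left₀ (by positivity)
    (by push_cast; linarith) _)) (by
      simp only [hgsum]
      exact (tendsto_pow_atTop (by omega)).comp tendsto_natCast_atTop_atTop)
  simp only [hgsum, Finset.sum_sub_distrib, ← Finset.mul_sum] at hsum
  have h2 := (hsum.tendsto_div_nhds_zero).add_const (e / (d + 1))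
  rw [zero_add] at h2
  refine h2.congr' ?_
  filter_upwards [eventually_gt_atTop 0] with n hn
  have hn' : (n : ℝ) ^ (d + 1) ≠ 0 := by positivity
  field_simp
  ring

/-! ### Lengths -/

/-- If the residue class ring `R ⧸ 𝔐` of an `A`-algebra `R` is a quotient of `A`, then the length
of a module killed by a power of `𝔐` is the same over `A` and over `R`. -/
lemma Module.length_eq_of_pow_smul_eq_bot {A R : Type*} [CommRing A] [CommRing R] [Algebra A R]
    {𝔐 : Ideal R} (hsurj : Function.Surjective (algebraMap A (R ⧸ 𝔐))) (k : ℕ) :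
    ∀ {M : Type*} [AddCommGroup M] [Module R M] [Module A M] [IsScalarTower A R M],
      𝔐 ^ k • (⊤ : Submodule R M) = ⊥ → Module.length R M = Module.length A M := by
  induction k with
  | zero =>
    intro M _ _ _ _ h
    rw [pow_zero, Ideal.one_eq_top, Submodule.top_smul] at h
    have : Subsingleton M := Submodule.subsingleton_iff R |>.1 (subsingleton_of_bot_eq_top h.symm)
    rw [Module.length_eq_zero, Module.length_eq_zero]
  | succ k ih =>
    intro M _ _ _ _ h
    let N : Submodule R M := 𝔐 • ⊤
    have hN : 𝔐 ^ k • (⊤ : Submodule R N) = ⊥ := by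
      refine (Submodule.map_injective_of_injective N.injective_subtype) ?_
      rw [Submodule.map_smul'', Submodule.map_top, Submodule.range_subtype, Submodule.map_bot,
        ← Submodule.mul_smul, ← pow_succ, h]
    have h1 := ih hN
    have : IsScalarTower A (R ⧸ 𝔐) (M ⧸ N) := ⟨fun a r m => by
      obtain ⟨r, rfl⟩ := Ideal.Quotient.mk_surjective r
      obtain ⟨m, rfl⟩ := Submodule.Quotient.mk_surjective _ m
      change Submodule.Quotient.mk ((a • r) • m) = a • Submodule.Quotient.mk (r • m)
      rw [smul_assoc]
      rfl⟩
    have : IsScalarTower R (R ⧸ 𝔐) (M ⧸ N) := ⟨fun a r m => by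
      obtain ⟨r, rfl⟩ := Ideal.Quotient.mk_surjective r
      obtain ⟨m, rfl⟩ := Submodule.Quotient.mk_surjective _ m
      change Submodule.Quotient.mk ((a • r) • m) = a • Submodule.Quotient.mk (r • m)
      rw [smul_assoc]
      rfl⟩
    have h2 : Module.length R (M ⧸ N) = Module.length A (M ⧸ N) := by
      rw [Module.length_eq_of_surjective (R := R ⧸ 𝔐) (S := R) Ideal.Quotient.mk_surjective,
        Module.length_eq_of_surjective (R := R ⧸ 𝔐) (S := A) hsurj]
    rw [Module.length_eq_add_of_exact N.subtype N.mkQ N.injective_subtype N.mkQ_surjective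
        (LinearMap.exact_subtype_mkQ N),
      Module.length_eq_add_of_exact (N.subtype.restrictScalars A) (N.mkQ.restrictScalars A)
        N.injective_subtype N.mkQ_surjective (LinearMap.exact_subtype_mkQ N), h1, h2]

lemma Module.length_quotient_map_of_surjective {R S : Type*} [CommRing R] [CommRing S]
    {f : R →+* S} (hf : Function.Surjective f) (𝔟 : Ideal R) :
    Module.length S (S ⧸ 𝔟.map f) = Module.length R (R ⧸ (𝔟 ⊔ RingHom.ker f)) := by
  algebraize [f]
  rw [← Module.length_eq_of_surjective (S := R) (R := S) hf]
  let g : R →ₗ[R] S ⧸ 𝔟.map f :=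
    ((𝔟.map f).mkQ.restrictScalars R).comp (Algebra.linearMap R S)
  have hg : Function.Surjective g := (Submodule.mkQ_surjective _).comp hf
  have hker : LinearMap.ker g = 𝔟 ⊔ RingHom.ker f := by
    rw [← Ideal.comap_map_of_surjective' f hf]
    ext r
    exact Ideal.Quotient.eq_zero_iff_mem (a := f r)
  rw [← hker]
  exact (g.quotKerEquivOfSurjective hg).length_eq.symm

lemma Module.length_quotient_le_of_le {A R : Type*} [CommRing A] [CommRing R] [Algebra A R]
    {𝔠 𝔡 : Ideal R} (h : 𝔠 ≤ 𝔡) : Module.length A (R ⧸ 𝔡) ≤ Module.length A (R ⧸ 𝔠) :=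
  Module.length_le_of_surjective (Ideal.Quotient.factorₐ A h).toLinearMap
    (Ideal.Quotient.factor_surjective h)

lemma Module.length_localization_quotient_pow {R : Type*} [CommRing R] (p : Ideal R) [p.IsMaximal]
    (n : ℕ) : Module.length (Localization.AtPrime p) (Localization.AtPrime p ⧸
      IsLocalRing.maximalIdeal (Localization.AtPrime p) ^ n) = Module.length R (R ⧸ p ^ n) := by
  let e := IsLocalization.AtPrime.equivQuotMaximalIdealPow p (Localization.AtPrime p) n
  rw [e.toLinearEquiv.length_eq,
    Module.length_eq_of_surjective (R := Localization.AtPrime p ⧸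
      IsLocalRing.maximalIdeal (Localization.AtPrime p) ^ n) (S := R) ?_,
    Module.length_eq_of_surjective (R := Localization.AtPrime p ⧸
      IsLocalRing.maximalIdeal (Localization.AtPrime p) ^ n) (S := Localization.AtPrime p)
      Ideal.Quotient.mk_surjective]
  intro y
  obtain ⟨z, rfl⟩ := e.surjective y
  obtain ⟨r, rfl⟩ := Ideal.Quotient.mk_surjective z
  exact ⟨r, (e.commutes r).symm⟩

/-! ### The Hilbert function of the fiber cone -/

namespace IdealFiltration

variable {A : Type u} [CommRing A] {F : IdealFiltration A} {J : Ideal A}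

lemma fiberLength_ne_top [IsNoetherianRing A] [IsLocalRing A] (F : IdealFiltration A)
    (hJ : J.radical = IsLocalRing.maximalIdeal A) (n : ℕ) : F.fiberLength J n ≠ ⊤ := by
  have := krullDimLE_zero_quotient_of_radical_eq hJ
  have : IsArtinianRing (A ⧸ J) := isArtinianRing_iff_krullDimLE_zero.2 this
  have : IsScalarTower A (A ⧸ J) (F.I n ⧸ (J • ⊤ : Submodule A (F.I n))) := ⟨fun a r m => by
    obtain ⟨r, rfl⟩ := Ideal.Quotient.mk_surjective r
    obtain ⟨m, rfl⟩ := Submodule.Quotient.mk_surjective _ m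
    change Submodule.Quotient.mk ((a • r) • m) = a • Submodule.Quotient.mk (r • m)
    rw [smul_assoc]
    rfl⟩
  have : Module.Finite (A ⧸ J) (F.I n ⧸ (J • ⊤ : Submodule A (F.I n))) :=
    Module.Finite.of_restrictScalars_finite A _ _
  rw [fiberLength, Module.length_eq_of_surjective (R := A ⧸ J) (S := A)
    Ideal.Quotient.mk_surjective]
  exact Module.length_ne_top

lemma mk_eq_zero_iff {n : ℕ} {a : F.I n} :
    (Submodule.Quotient.mk a : F.I n ⧸ (J • ⊤ : Submodule A (F.I n))) = 0 ↔
      (a : A) ∈ J * F.I n := by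
  rw [Submodule.Quotient.mk_eq_zero, Submodule.mem_smul_top_iff, smul_eq_mul]

lemma IsNilpotent.eventually_fiberLength_eq_zero (h : F.IsNilpotent) :
    ∀ᶠ n in atTop, F.fiberLength J n = 0 := by
  filter_upwards [h] with n hn
  have : Subsingleton (F.I n) := by rw [hn]; infer_instance
  rw [fiberLength, Module.length_eq_zero]

/-- Modulo a weak-(FC)-element the Hilbert function of the fiber cone becomes, in large degrees,
the difference function of the original one: multiplication by `x t` is injective there, and its
cokernel is the fiber cone of `F / (x)`. -/
theorem IsWeakFCElement.eventually_fiberLength_add [IsNoetherianRing A] {x : A}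
    (hx : F.IsWeakFCElement J x) :
    ∀ᶠ n in atTop, F.fiberLength J (n + 1) = F.fiberLength J n +
      (F.quotient (Ideal.span {x})).fiberLength (J.map (Ideal.Quotient.mk (Ideal.span {x}))) (n + 1)
      := by
  filter_upwards [hx.eventually_mem_of_mul_mem, hx.2.2.1] with n hinj hFC
  let G := F.quotient (Ideal.span {x})
  let J' := J.map (Ideal.Quotient.mk (Ideal.span {x}))
  have hmul : ∀ a : F.I n, x * a ∈ F.I (n + 1) := fun a => by
    rw [add_comm]; exact F.I_mul_le 1 n (Ideal.mul_mem_mul hx.2.1 a.2)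
  let α₀ : F.I n →ₗ[A] F.I (n + 1) := ((LinearMap.mulLeft A x).comp (F.I n).subtype).codRestrict
    (F.I (n + 1)) hmul
  let α : (F.I n ⧸ (J • ⊤ : Submodule A (F.I n))) →ₗ[A]
      (F.I (n + 1) ⧸ (J • ⊤ : Submodule A (F.I (n + 1)))) :=
    Submodule.mapQ _ _ α₀ (by
      intro a ha
      rw [Submodule.mem_smul_top_iff, smul_eq_mul] at ha
      rw [Submodule.mem_comap, Submodule.mem_smul_top_iff, smul_eq_mul]
      change x * (a : A) ∈ _
      have := Ideal.mul_mem_mul hx.2.1 ha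
      rw [mul_left_comm] at this
      rw [add_comm n]
      exact Ideal.mul_mono_right (F.I_mul_le 1 n) this)
  have hα : ∀ a : F.I n, α (Submodule.Quotient.mk a) = Submodule.Quotient.mk ⟨x * a, hmul a⟩ :=
    fun a => rfl
  have hG : ∀ a : F.I (n + 1), Ideal.Quotient.mk (Ideal.span {x}) (a : A) ∈ G.I (n + 1) :=
    fun a => Ideal.mem_map_of_mem _ a.2
  let γ : F.I (n + 1) →ₗ[A] G.I (n + 1) :=
    { toFun := fun a => ⟨Ideal.Quotient.mk _ (a : A), hG a⟩
      map_add' := fun a b => rfl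
      map_smul' := fun r a => Subtype.ext (by
        change Ideal.Quotient.mk (Ideal.span {x}) (r * (a : A)) = r • Ideal.Quotient.mk _ (a : A)
        rw [map_mul, Algebra.smul_def]
        rfl) }
  let β₀ : F.I (n + 1) →ₗ[A] (G.I (n + 1) ⧸ (J' • ⊤ : Submodule _ (G.I (n + 1)))) :=
    ((J' • ⊤ : Submodule (A ⧸ Ideal.span {x}) (G.I (n + 1))).mkQ.restrictScalars A).comp γ
  have hβ₀ : ∀ a : F.I (n + 1), β₀ a = 0 ↔ (a : A) ∈ J * F.I (n + 1) ⊔ Ideal.span {x} := by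
    intro a
    have h1 : β₀ a = 0 ↔ Ideal.Quotient.mk (Ideal.span {x}) (a : A) ∈ J' * G.I (n + 1) :=
      mk_eq_zero_iff (F := G) (J := J')
    rw [h1, show J' * G.I (n + 1) = (J * F.I (n + 1)).map (Ideal.Quotient.mk (Ideal.span {x})) from
      (Ideal.map_mul _ _ _).symm, ← Ideal.mem_comap,
      Ideal.comap_map_of_surjective' _ Ideal.Quotient.mk_surjective, Ideal.mk_ker]
  let β : (F.I (n + 1) ⧸ (J • ⊤ : Submodule A (F.I (n + 1)))) →ₗ[A]
      (G.I (n + 1) ⧸ (J' • ⊤ : Submodule _ (G.I (n + 1)))) :=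
    Submodule.liftQ _ β₀ (by
      intro a ha
      rw [Submodule.mem_smul_top_iff, smul_eq_mul] at ha
      exact (hβ₀ a).2 (Ideal.mem_sup_left ha))
  have hβ : ∀ a, β (Submodule.Quotient.mk a) = β₀ a := fun a => rfl
  have hαinj : Function.Injective α := by
    rw [injective_iff_map_eq_zero]
    intro y hy
    obtain ⟨a, rfl⟩ := Submodule.Quotient.mk_surjective _ y
    rw [hα, mk_eq_zero_iff] at hy
    exact mk_eq_zero_iff.2 (hinj a a.2 hy)
  have hβsurj : Function.Surjective β := by
    intro y
    obtain ⟨⟨b, hb⟩, rfl⟩ := Submodule.Quotient.mk_surjective _ y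
    obtain ⟨a, ha, rfl⟩ := (Ideal.mem_map_iff_of_surjective _ Ideal.Quotient.mk_surjective).1 hb
    exact ⟨Submodule.Quotient.mk ⟨a, ha⟩, rfl⟩
  have hexact : Function.Exact α β := by
    intro y
    obtain ⟨a, rfl⟩ := Submodule.Quotient.mk_surjective _ y
    constructor
    · intro hy
      rw [hβ, hβ₀] at hy
      obtain ⟨b, hb, c, hc, hbc⟩ := Submodule.mem_sup.1 hy
      have hc' : c ∈ J ^ 0 * F.I (n + 1) ⊓ Ideal.span {x} := by
        refine ⟨?_, hc⟩
        rw [pow_zero, Ideal.one_eq_top, Ideal.top_mul]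
        exact (Ideal.add_mem_iff_right _ (Ideal.mul_le_right hb)).1 (hbc ▸ a.2)
      rw [hFC 0, pow_zero, Ideal.one_eq_top, Ideal.top_mul, Ideal.mem_span_singleton_mul] at hc'
      obtain ⟨d, hd, rfl⟩ := hc'
      refine ⟨Submodule.Quotient.mk ⟨d, hd⟩, ?_⟩
      rw [hα, ← sub_eq_zero, ← Submodule.Quotient.mk_sub, mk_eq_zero_iff]
      have : (((⟨x * d, hmul ⟨d, hd⟩⟩ : F.I (n + 1)) - a : F.I (n + 1)) : A) = -b := by
        rw [AddSubgroupClass.coe_sub, ← hbc]; ring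
      rw [this]
      exact Submodule.neg_mem _ hb
    · rintro ⟨y, hy⟩
      obtain ⟨d, rfl⟩ := Submodule.Quotient.mk_surjective _ y
      rw [← hy, hα, hβ, hβ₀]
      exact Ideal.mem_sup_right (Ideal.mul_mem_right _ _ (Ideal.mem_span_singleton_self x))
  have : IsScalarTower A (A ⧸ Ideal.span {x})
      (G.I (n + 1) ⧸ (J' • ⊤ : Submodule (A ⧸ Ideal.span {x}) (G.I (n + 1)))) := ⟨fun a r m => by
    obtain ⟨r, rfl⟩ := Ideal.Quotient.mk_surjective r
    obtain ⟨m, rfl⟩ := Submodule.Quotient.mk_surjective _ m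
    change Submodule.Quotient.mk ((a • Ideal.Quotient.mk (Ideal.span {x}) r) • m) =
      Submodule.Quotient.mk (a • (Ideal.Quotient.mk (Ideal.span {x}) r • m))
    rw [smul_assoc]⟩
  have hG' : Module.length (A ⧸ Ideal.span {x})
      (G.I (n + 1) ⧸ (J' • ⊤ : Submodule (A ⧸ Ideal.span {x}) (G.I (n + 1)))) =
      Module.length A
        (G.I (n + 1) ⧸ (J' • ⊤ : Submodule (A ⧸ Ideal.span {x}) (G.I (n + 1)))) :=
    (Module.length_eq_of_surjective Ideal.Quotient.mk_surjective).symm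
  exact (Module.length_eq_add_of_exact α β hαinj hβsurj hexact).trans
    (congrArg (F.fiberLength J n + ·) hG'.symm)

section Local

variable [IsNoetherianRing A] [IsLocalRing A]

lemma IsWeakFCElement.eventually_toNat_fiberLength
    (hJ : J.radical = IsLocalRing.maximalIdeal A) {x : A} (hx : F.IsWeakFCElement J x) :
    ∀ᶠ n in atTop, ((F.fiberLength J (n + 1)).toNat : ℝ) = (F.fiberLength J n).toNat +
      (((F.quotient (Ideal.span {x})).fiberLength
        (J.map (Ideal.Quotient.mk (Ideal.span {x}))) (n + 1)).toNat : ℝ) := by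
  have := hx.1.1.nontrivial_quotient hx.span_le
  have hloc : IsLocalRing (A ⧸ Ideal.span {x}) :=
    IsLocalRing.of_surjective' (Ideal.Quotient.mk _) Ideal.Quotient.mk_surjective
  filter_upwards [hx.eventually_fiberLength_add] with n hn
  rw [hn, ENat.toNat_add (fiberLength_ne_top F hJ n) (fiberLength_ne_top _
    (IsLocalRing.radical_map_of_surjective Ideal.Quotient.mk_surjective hJ) _), Nat.cast_add]

/-- If the normalized leading coefficient of the Hilbert function of `F / (x)` in degree `d`
exists, then that of `F` in degree `d + 1` exists and is the same. -/
lemma IsWeakFCElement.tendsto_fiberLength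
    (hJ : J.radical = IsLocalRing.maximalIdeal A) {x : A} (hx : F.IsWeakFCElement J x)
    {d : ℕ} {e : ℝ} (h : Tendsto (fun n : ℕ => ((d ! : ℕ) : ℝ) *
      (((F.quotient (Ideal.span {x})).fiberLength
        (J.map (Ideal.Quotient.mk (Ideal.span {x}))) n).toNat : ℝ) / (n : ℝ) ^ d) atTop (𝓝 e)) :
    Tendsto (fun n : ℕ => (((d + 1)! : ℕ) : ℝ) * ((F.fiberLength J n).toNat : ℝ) /
      (n : ℝ) ^ (d + 1)) atTop (𝓝 e) := by
  let H : ℕ → ℝ := fun n => ((F.fiberLength J n).toNat : ℝ)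
  have h1 : Tendsto (fun n : ℕ => ((d ! : ℕ) : ℝ) * (H (n + 1) - H n) / (n : ℝ) ^ d)
      atTop (𝓝 e) := by
    refine (tendsto_add_div_add_pow h 1 0).congr' ?_
    filter_upwards [hx.eventually_toNat_fiberLength hJ] with n hn
    simp only [H, hn, add_zero, add_sub_cancel_left]
  have h2 := tendsto_sum_range_div_pow h1
  simp only [← Finset.mul_sum, Finset.sum_range_sub] at h2
  have h3 : Tendsto (fun n : ℕ => (((d + 1)! : ℕ) : ℝ) * H 0 / (n : ℝ) ^ (d + 1)) atTop (𝓝 0) :=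
    tendsto_const_nhds.div_atTop ((tendsto_pow_atTop (by omega)).comp tendsto_natCast_atTop_atTop)
  have h4 := (h2.const_mul ((d : ℝ) + 1)).add h3
  rw [add_zero, mul_div_cancel₀ _ (by positivity : (d + 1 : ℝ) ≠ 0)] at h4
  refine h4.congr fun n => ?_
  rw [Nat.factorial_succ]
  push_cast
  ring

end Local

/-- The Hilbert function of the fiber cone grows like `n ^ (ℓ - 1)`. -/
theorem FCChain.exists_tendsto_fiberLength {xs : List A} (h : FCChain F J xs) :
    ∀ [IsNoetherianRing A] [IsLocalRing A], J.radical = IsLocalRing.maximalIdeal A →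
      0 < xs.length → ∃ e : ℝ, Tendsto (fun n : ℕ => (((xs.length - 1)! : ℕ) : ℝ) *
        ((F.fiberLength J n).toNat : ℝ) / (n : ℝ) ^ (xs.length - 1)) atTop (𝓝 e) := by
  induction h with
  | nil h => intro _ _ _ h; exact absurd h (lt_irrefl 0)
  | @cons A _ F J x xs hx hxs ih =>
    intro _ _ hJ _
    have := hx.1.1.nontrivial_quotient hx.span_le
    have hloc : IsLocalRing (A ⧸ Ideal.span {x}) :=
      IsLocalRing.of_surjective' (Ideal.Quotient.mk _) Ideal.Quotient.mk_surjective
    cases xs with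
    | nil =>
      -- the Hilbert function is eventually constant
      have hnil : (F.quotient (Ideal.span {x})).IsNilpotent := by
        cases hxs; assumption
      obtain ⟨N, hN⟩ := eventually_atTop.1 ((hx.eventually_toNat_fiberLength hJ).and
        ((tendsto_add_atTop_nat 1).eventually (hnil.eventually_fiberLength_eq_zero
          (J := J.map (Ideal.Quotient.mk (Ideal.span {x}))))))
      refine ⟨((F.fiberLength J N).toNat : ℝ), tendsto_const_nhds.congr' ?_⟩
      filter_upwards [eventually_ge_atTop N] with n hn
      simp only [List.length_cons, List.length_nil, zero_add, Nat.sub_self, Nat.factorial_zero,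
        Nat.cast_one, one_mul, pow_zero, div_one]
      induction n, hn using Nat.le_induction with
      | base => rfl
      | succ n hn ih' =>
        rw [(hN n hn).1, (hN n hn).2, ← ih']
        simp
    | cons y ys =>
      obtain ⟨e, he⟩ := ih (IsLocalRing.radical_map_of_surjective Ideal.Quotient.mk_surjective hJ)
        (by simp)
      exact ⟨e, by simpa using hx.tendsto_fiberLength hJ (d := ys.length) (by simpa using he)⟩

/-! ### The multiplicities of the fiber cone -/

/-- The homogeneous ideal of the Rees algebra with the components `J I_i` in degrees `i < n` and
`I_i` in degrees `i ≥ n`: its residue class ring is the fiber cone truncated at degree `n`. -/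
noncomputable def truncIdeal (F : IdealFiltration A) (J : Ideal A) (n : ℕ) : Ideal F.rees :=
  F.gradedIdeal (fun i => if i < n then J * F.I i else F.I i) (by
    intro m i
    split_ifs with h₁ h₂ h₂
    · rw [mul_left_comm]; exact Ideal.mul_mono_right (F.I_mul_le m i)
    · rw [mul_left_comm]; exact Ideal.mul_le_right.trans (F.I_mul_le m i)
    · omega
    · exact F.I_mul_le m i)

lemma length_quotient_truncIdeal (F : IdealFiltration A) (J : Ideal A) (n : ℕ) :
    Module.length A (F.rees ⧸ F.truncIdeal J n) = ∑ i ∈ Finset.range n, F.fiberLength J i := by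
  let g : F.rees →ₗ[A] ((i : Fin n) → F.I i ⧸ (J • ⊤ : Submodule A (F.I i))) :=
    { toFun := fun p i => Submodule.Quotient.mk ⟨(p : A[X]).coeff i, p.2 i⟩
      map_add' := fun p q => by
        ext i
        rw [Pi.add_apply, ← Submodule.Quotient.mk_add]
        exact congrArg _ (Subtype.ext (coeff_add _ _ _))
      map_smul' := fun r p => by
        ext i
        rw [Pi.smul_apply, RingHom.id_apply, ← Submodule.Quotient.mk_smul]
        exact congrArg _ (Subtype.ext (coeff_smul _ _ _)) }
  have hg : Function.Surjective g := by
    intro y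
    choose a ha using fun i => Submodule.Quotient.mk_surjective _ (y i)
    have hcoeff : ∀ j : Fin n,
        ((∑ i : Fin n, F.reesMonomial i (a i) : F.rees) : A[X]).coeff j = a j := by
      intro j
      rw [AddSubmonoidClass.coe_finsetSum, finsetSum_coeff, Finset.sum_eq_single j]
      · simp
      · intro i _ hij
        rw [coe_reesMonomial, coeff_monomial, if_neg (fun h => hij (Fin.ext h))]
      · simp
    refine ⟨∑ i : Fin n, F.reesMonomial i (a i), funext fun j => ?_⟩
    rw [← ha j]
    exact congrArg _ (Subtype.ext (hcoeff j))
  have hker : LinearMap.ker g = (F.truncIdeal J n).restrictScalars A := by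
    ext p
    rw [LinearMap.mem_ker, Submodule.restrictScalars_mem, truncIdeal, mem_gradedIdeal, funext_iff]
    constructor
    · intro h i
      split_ifs with hi
      · exact mk_eq_zero_iff.1 (h ⟨i, hi⟩)
      · exact p.2 i
    · intro h i
      have h1 := h i
      rw [if_pos i.2] at h1
      exact mk_eq_zero_iff.2 h1
  have h1 : Module.length A (F.rees ⧸ LinearMap.ker g) =
      ∑ i ∈ Finset.range n, F.fiberLength J i := by
    rw [(g.quotKerEquivOfSurjective hg).length_eq, Module.length_pi_of_fintype,
      Finset.sum_range]
    rfl
  rw [← h1, hker]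
  exact LinearEquiv.length_eq (Submodule.Quotient.restrictScalarsEquiv A (F.truncIdeal J n)).symm

/-- Since `I_{c+n} = K^n I_c`, components of high degree of the Rees algebra lie in high powers of
its irrelevant ideal. -/
lemma IsGoodFor.exists_truncIdeal_le {K : Ideal A} (h : F.IsGoodFor K) (J : Ideal A) :
    ∃ c, ∀ n, F.truncIdeal J (n + c) ≤
      RingHom.ker F.reesProj ^ n ⊔ J.map (algebraMap A F.rees) := by
  obtain ⟨c, hc⟩ := h.exists_eq_pow_mul
  have hspan : F.reesSpan h.le_one ≤ RingHom.ker F.reesProj := by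
    refine Ideal.span_le.2 ?_
    rintro _ ⟨k, rfl⟩
    change F.reesProj _ = 0
    simp [coeff_monomial]
  refine ⟨c, fun n p hp => ?_⟩
  rw [F.eq_sum_reesMonomial p]
  refine Ideal.sum_mem _ fun i _ => ?_
  have hpi := mem_gradedIdeal.1 hp i
  split_ifs at hpi with hi
  · exact Ideal.mem_sup_right (F.reesMonomial_mem_map.2 hpi)
  · refine Ideal.mem_sup_left ?_
    obtain ⟨k, rfl⟩ := Nat.exists_eq_add_of_le (show c ≤ i by omega)
    have key : F.I (c + k) ≤ Submodule.map (F.I (c + k)).subtype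
        (Submodule.comap (F.reesMonomial (c + k))
          ((RingHom.ker F.reesProj ^ n).restrictScalars A)) := by
      refine (hc k).le.trans (Ideal.mul_le.2 fun w hw b hb => ?_)
      have hwb : w * b ∈ F.I (c + k) := hc k ▸ Ideal.mul_mem_mul hw hb
      refine ⟨⟨w * b, hwb⟩, ?_, rfl⟩
      have h1 := Ideal.pow_le_pow_right (show n ≤ k by omega)
        (Ideal.pow_right_mono hspan k (F.reesMonomial_mem_reesSpan_pow h.le_one k hw))
      have h2 := Ideal.mul_mem_right (F.reesMonomial c ⟨b, hb⟩) _ h1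
      have h3 : F.reesMonomial k ⟨w, F.pow_I_one_le k (Ideal.pow_right_mono h.le_one k hw)⟩ *
          F.reesMonomial c ⟨b, hb⟩ = F.reesMonomial (c + k) ⟨w * b, hwb⟩ :=
        Subtype.ext (by simp [monomial_mul_monomial, add_comm])
      exact (congrArg (· ∈ RingHom.ker F.reesProj ^ n) h3).mp h2
    obtain ⟨a, ha, hae⟩ := key (p.2 (c + k))
    have : a = ⟨(p : A[X]).coeff (c + k), p.2 (c + k)⟩ := Subtype.ext hae
    exact this ▸ ha

variable [IsLocalRing A]

lemma ker_reesProj_le_reesMax : RingHom.ker F.reesProj ≤ F.reesMax :=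
  Ideal.comap_mono bot_le

/-- As `𝔪` is nilpotent modulo `J`, high powers of the maximal homogeneous ideal lie in high
degrees modulo `J`. -/
lemma exists_reesMax_pow_le [IsNoetherianRing A] (F : IdealFiltration A)
    (hJ : J.radical = IsLocalRing.maximalIdeal A) :
    ∃ r, ∀ n, F.reesMax ^ (n + r) ⊔ J.map (algebraMap A F.rees) ≤ F.truncIdeal J n := by
  obtain ⟨r, hr⟩ := Ideal.exists_pow_le_of_le_radical_of_fg hJ.ge (IsNoetherian.noetherian _)
  have hJle : ∀ n, J.map (algebraMap A F.rees) ≤ F.truncIdeal J n := by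
    intro n p hp i
    have h1 := F.mem_map_algebraMap_rees.1 hp i
    change _ ∈ (if i < n then J * F.I i else F.I i)
    split_ifs
    · exact h1
    · exact Ideal.mul_le_right h1
  refine ⟨r, fun n => sup_le ?_ (hJle n)⟩
  have h1 : F.reesMax ≤ RingHom.ker F.reesProj ⊔
      (IsLocalRing.maximalIdeal A).map (algebraMap A F.rees) := by
    intro p hp
    rw [← sub_add_cancel p (algebraMap A F.rees ((p : A[X]).coeff 0))]
    refine Submodule.add_mem_sup ?_ (Ideal.mem_map_of_mem _ hp)
    rw [RingHom.mem_ker, map_sub, reesProj_apply, reesProj_apply, coe_algebraMap_rees, coeff_C_zero,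
      sub_self]
  have h2 : (IsLocalRing.maximalIdeal A).map (algebraMap A F.rees) ^ r ≤
      J.map (algebraMap A F.rees) := by
    rw [← Ideal.map_pow]; exact Ideal.map_mono hr
  have h3 : RingHom.ker F.reesProj ^ n ≤ F.truncIdeal J n := by
    have hX : (RingHom.ker F.reesProj).map F.rees.val.toRingHom ≤ Ideal.span {X} := by
      refine Ideal.map_le_iff_le_comap.2 fun p hp => ?_
      exact Ideal.mem_span_singleton.2 (X_dvd_iff.2 hp)
    intro p hp i
    have h4 := Ideal.mem_map_of_mem F.rees.val.toRingHom hp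
    rw [Ideal.map_pow] at h4
    have h5 := Ideal.pow_right_mono hX n h4
    rw [Ideal.span_singleton_pow, Ideal.mem_span_singleton] at h5
    change _ ∈ (if i < n then J * F.I i else F.I i)
    split_ifs with hi
    · have h6 : (p : A[X]).coeff i = 0 := X_pow_dvd_iff.1 h5 i hi
      rw [h6]
      exact Ideal.zero_mem _
    · exact p.2 i
  exact (Ideal.pow_right_mono h1 _).trans ((Ideal.sup_pow_add_le_pow_sup_pow).trans
    (sup_le h3 (h2.trans (hJle n))))

lemma surjective_algebraMap_quotient_reesMax (F : IdealFiltration A) :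
    Function.Surjective (algebraMap A (F.rees ⧸ F.reesMax)) := by
  intro y
  obtain ⟨p, rfl⟩ := Ideal.Quotient.mk_surjective y
  refine ⟨(p : A[X]).coeff 0, ?_⟩
  change Ideal.Quotient.mk F.reesMax (algebraMap A F.rees _) = _
  rw [Ideal.Quotient.eq, mem_reesMax]
  change ((algebraMap A F.rees ((p : A[X]).coeff 0) : A[X]) - p).coeff 0 ∈ _
  rw [coeff_sub, coe_algebraMap_rees, coeff_C_zero, sub_self]
  exact Ideal.zero_mem _

end IdealFiltration

/-- If `a` is squeezed between shifts of the partial sums of a sequence `h` with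
`d! h_n / n ^ d → e`, then `(d + 1)! a_n / n ^ (d + 1) → e`. -/
lemma tendsto_of_sum_range_le {a h : ℕ → ℝ} {d : ℕ} {e : ℝ}
    (hh : Tendsto (fun n : ℕ => ((d ! : ℕ) : ℝ) * h n / (n : ℝ) ^ d) atTop (𝓝 e)) {r c : ℕ}
    (hlow : ∀ n, ∑ i ∈ Finset.range n, h i ≤ a (n + r))
    (hup : ∀ n, a n ≤ ∑ i ∈ Finset.range (n + c), h i) :
    Tendsto (fun n : ℕ => (((d + 1)! : ℕ) : ℝ) * a n / (n : ℝ) ^ (d + 1)) atTop (𝓝 e) := by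
  have hsum : Tendsto (fun n : ℕ => (((d + 1)! : ℕ) : ℝ) * (∑ i ∈ Finset.range n, h i) /
      (n : ℝ) ^ (d + 1)) atTop (𝓝 e) := by
    have h2 := (tendsto_sum_range_div_pow hh).const_mul ((d : ℝ) + 1)
    rw [mul_div_cancel₀ _ (by positivity : (d + 1 : ℝ) ≠ 0)] at h2
    refine h2.congr fun n => ?_
    rw [← Finset.mul_sum, Nat.factorial_succ]
    push_cast
    ring
  rw [← tendsto_add_atTop_iff_nat r]
  refine tendsto_of_tendsto_of_tendsto_of_le_of_le (tendsto_add_div_add_pow hsum 0 r)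
    (tendsto_add_div_add_pow hsum (r + c) r) (fun n => ?_) (fun n => ?_)
  · change _ / _ ≤ _ / _
    gcongr
    exact hlow n
  · change _ / _ ≤ _ / _
    gcongr
    rw [← add_assoc]
    exact hup (n + r)

namespace IdealFiltration

variable {A : Type u} [CommRing A] [IsLocalRing A] [IsNoetherianRing A] {F : IdealFiltration A}
  {J : Ideal A}

/-- The ideals `F_J(F)^+` and the maximal homogeneous ideal of the fiber cone are the images of
ideals `𝔞` of the Rees algebra between its irrelevant ideal and `𝔐`. For all of these, the
lengths of the residue class rings modulo powers are, up to a shift, the partial sums of the Hilbert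
function. -/
theorem IsGoodFor.exists_length_bounds {K : Ideal A} (h : F.IsGoodFor K)
    (hJ : J.radical = IsLocalRing.maximalIdeal A) {𝔞 : Ideal F.rees}
    (h₁ : RingHom.ker F.reesProj ≤ 𝔞) (h₂ : 𝔞 ≤ F.reesMax) :
    ∃ r c : ℕ, ∀ n,
      ∑ i ∈ Finset.range n, F.fiberLength J i ≤
        Module.length (F.fiberCone J) (F.fiberCone J ⧸ 𝔞.map (F.fiberMk J) ^ (n + r)) ∧
      Module.length (F.fiberCone J) (F.fiberCone J ⧸ 𝔞.map (F.fiberMk J) ^ n) ≤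
        ∑ i ∈ Finset.range (n + c), F.fiberLength J i := by
  obtain ⟨c, hc⟩ := h.exists_truncIdeal_le J
  obtain ⟨r, hr⟩ := F.exists_reesMax_pow_le hJ
  have hc' : ∀ n, F.truncIdeal J (n + c) ≤ 𝔞 ^ n ⊔ J.map (algebraMap A F.rees) :=
    fun n => (hc n).trans (sup_le_sup_right (Ideal.pow_right_mono h₁ n) _)
  have hlen : ∀ n, Module.length (F.fiberCone J) (F.fiberCone J ⧸ 𝔞.map (F.fiberMk J) ^ n) =
      Module.length A (F.rees ⧸ (𝔞 ^ n ⊔ J.map (algebraMap A F.rees))) := by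
    intro n
    rw [← Ideal.map_pow, Module.length_quotient_map_of_surjective (F.fiberMk_surjective J),
      ker_fiberMk]
    refine Module.length_eq_of_pow_smul_eq_bot F.surjective_algebraMap_quotient_reesMax
      (n + c + r) ?_
    refine eq_bot_iff.2 (Submodule.smul_le.2 fun s hs y _ => ?_)
    obtain ⟨q, rfl⟩ := Ideal.Quotient.mk_surjective y
    rw [Submodule.mem_bot]
    refine Ideal.Quotient.eq_zero_iff_mem.2 (?_ : s * q ∈ _)
    exact Ideal.mul_mem_right q _ (hc' n (hr (n + c) (Ideal.mem_sup_left hs)))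
  refine ⟨r, c, fun n => ⟨?_, ?_⟩⟩
  · rw [hlen, ← length_quotient_truncIdeal]
    exact Module.length_quotient_le_of_le
      ((sup_le_sup_right (Ideal.pow_right_mono h₂ _) _).trans (hr n))
  · rw [hlen, ← length_quotient_truncIdeal]
    exact Module.length_quotient_le_of_le (hc' n)

/-- The residue class rings of the fiber cone modulo the powers of the image of `𝔞` have finite
length, and the normalized leading coefficient of this length is that of the Hilbert function. -/
theorem IsGoodFor.tendsto_length {K : Ideal A} (h : F.IsGoodFor K)
    (hJ : J.radical = IsLocalRing.maximalIdeal A) {𝔞 : Ideal F.rees}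
    (h₁ : RingHom.ker F.reesProj ≤ 𝔞) (h₂ : 𝔞 ≤ F.reesMax) {d : ℕ} {e : ℝ}
    (he : Tendsto (fun n : ℕ => ((d ! : ℕ) : ℝ) *
      ((F.fiberLength J n).toNat : ℝ) / (n : ℝ) ^ d) atTop (𝓝 e)) :
    (∀ n : ℕ, Module.length (F.fiberCone J) (F.fiberCone J ⧸ 𝔞.map (F.fiberMk J) ^ n) ≠ ⊤) ∧
    Tendsto (fun n : ℕ => (((d + 1)! : ℕ) : ℝ) * ((Module.length (F.fiberCone J)
      (F.fiberCone J ⧸ 𝔞.map (F.fiberMk J) ^ n)).toNat : ℝ) / (n : ℝ) ^ (d + 1))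
      atTop (𝓝 e) := by
  obtain ⟨r, c, hrc⟩ := h.exists_length_bounds hJ h₁ h₂
  have hsum : ∀ n, ∑ i ∈ Finset.range n, F.fiberLength J i =
      ((∑ i ∈ Finset.range n, (F.fiberLength J i).toNat : ℕ) : ℕ∞) := by
    intro n
    rw [Nat.cast_sum]
    exact Finset.sum_congr rfl fun i _ => (ENat.natCast_toNat (fiberLength_ne_top F hJ i)).symm
  have hfin : ∀ n : ℕ,
      Module.length (F.fiberCone J) (F.fiberCone J ⧸ 𝔞.map (F.fiberMk J) ^ n) ≠ ⊤ :=
    fun n => ne_top_of_le_ne_top (by rw [hsum]; exact ENat.natCast_ne_top _) (hrc n).2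
  refine ⟨hfin, tendsto_of_sum_range_le he (r := r) (c := c) (fun n => ?_) (fun n => ?_)⟩
  · have h3 := (hrc n).1
    rw [hsum, ← ENat.natCast_toNat (hfin (n + r))] at h3
    exact_mod_cast h3
  · have h3 := (hrc n).2
    rw [hsum, ← ENat.natCast_toNat (hfin n)] at h3
    exact_mod_cast h3

lemma map_primeCompl_reesMax {A : Type u} [CommRing A] [IsLocalRing A] {F : IdealFiltration A}
    {J : Ideal A} (hJ : J ≤ IsLocalRing.maximalIdeal A) [(F.fiberMax J).IsPrime] :
    F.reesMax.primeCompl.map (F.fiberMk J) = (F.fiberMax J).primeCompl := by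
  ext y
  obtain ⟨p, rfl⟩ := F.fiberMk_surjective J y
  constructor
  · rintro ⟨q, hq, hqp⟩
    rw [← hqp]
    exact fun h => hq ((fiberMk_mem_fiberMax hJ).1 h)
  · exact fun h => ⟨p, fun hp => h ((fiberMk_mem_fiberMax hJ).2 hp), rfl⟩

end IdealFiltration

/-- The multiplicity of a maximal ideal can be computed before or after localization, provided that
its height is the dimension of the ring. -/
lemma hasLocalMultiplicity_localization {R : Type u} [CommRing R] {p : Ideal R} [p.IsMaximal]
    {d : ℕ} {e : ℝ} (hd : p.height = d) (hfin : ∀ n : ℕ, Module.length R (R ⧸ p ^ n) ≠ ⊤)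
    (he : Tendsto (fun n : ℕ => ((d ! : ℕ) : ℝ) * ((Module.length R (R ⧸ p ^ n)).toNat : ℝ) /
      (n : ℝ) ^ d) atTop (𝓝 e)) {S : Submonoid R} (hS : S = p.primeCompl) :
    HasLocalMultiplicity (Localization S) e := by
  subst hS
  refine ⟨inferInstanceAs (IsLocalRing (Localization.AtPrime p)), d, ?_, fun n => ?_, ?_⟩
  · rw [IsLocalization.AtPrime.ringKrullDim_eq_height p (Localization.AtPrime p), hd]
    rfl
  · exact (Module.length_localization_quotient_pow p n).trans_ne (hfin n)
  · refine he.congr fun n => ?_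
    rw [← Module.length_localization_quotient_pow p n]

namespace IdealFiltration

variable {A : Type u} [CommRing A] [IsLocalRing A] [IsNoetherianRing A] {F : IdealFiltration A}
  {J : Ideal A}

/-- The multiplicities of the fiber cone are the normalized leading coefficient of its Hilbert
function. -/
theorem FCChain.hasMultiplicity {xs : List A} (h : FCChain F J xs)
    (hJ : J.radical = IsLocalRing.maximalIdeal A) {d : ℕ} (hd : xs.length = d + 1) {e : ℝ}
    (he : Tendsto (fun n : ℕ => ((d ! : ℕ) : ℝ) *
      ((F.fiberLength J n).toNat : ℝ) / (n : ℝ) ^ d) atTop (𝓝 e)) :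
    F.HasFiberMultiplicity J e ∧ HasMultiplicity (F.fiberPos J) e := by
  have hJle : J ≤ IsLocalRing.maximalIdeal A := hJ ▸ Ideal.le_radical
  have hdim := h.ringKrullDim_fiberCone hJ
  rw [hd] at hdim
  have hmax := fiberMax_isMaximal (F := F) hJle
  obtain ⟨hfin₁, he₁⟩ := IsGoodFor.tendsto_length h.isReduction hJ le_rfl
    F.ker_reesProj_le_reesMax he
  obtain ⟨hfin₂, he₂⟩ := IsGoodFor.tendsto_length h.isReduction hJ
    F.ker_reesProj_le_reesMax le_rfl he
  exact ⟨⟨inferInstance, hasLocalMultiplicity_localization (p := F.fiberMax J) hdim.2 hfin₂ he₂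
    (map_primeCompl_reesMax hJle)⟩, d + 1, hdim.1, hfin₁, he₁⟩

end IdealFiltration

/-! ### Maximal weak-(FC)-sequences, reductions and the analytic spread -/

namespace IdealFiltration

variable {A : Type u} [CommRing A] {F : IdealFiltration A} {J : Ideal A}

lemma IsReduction.sup_of_le {K L : Ideal A} (h : F.IsReduction K)
    (hL : L ≤ F.I 1) : F.IsReduction (K ⊔ L) := by
  have hle : ∀ n, (K ⊔ L) * F.I n ≤ F.I (n + 1) := fun n => by
    rw [Ideal.sup_mul]
    refine sup_le (h.1 n) ((Ideal.mul_mono_left hL).trans ?_)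
    rw [add_comm]
    exact F.I_mul_le 1 n
  refine ⟨hle, ?_⟩
  filter_upwards [h.2] with n hn
  exact le_antisymm (hn.le.trans (Ideal.mul_mono_left le_sup_left)) (hle n)

lemma IsMaximalWeakFCSequence.isReduction {xs : List A} (h : F.IsMaximalWeakFCSequence J xs) :
    F.IsReduction (Ideal.ofList xs) :=
  h.fcChain.isReduction

lemma IsMaximalWeakFCSequence.analyticSpread [IsNoetherianRing A] [IsLocalRing A] {xs : List A}
    (h : F.IsMaximalWeakFCSequence J xs) (hJ : J.radical = IsLocalRing.maximalIdeal A) :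
    F.analyticSpread = xs.length :=
  h.fcChain.analyticSpread hJ

/-- Every weak-(FC)-sequence can be extended to a maximal one. -/
lemma IsWeakFCSequence.exists_append [IsNoetherianRing A] [IsLocalRing A]
    [Infinite (IsLocalRing.ResidueField A)] (hF : F.IsGood) {xs : List A}
    (h : F.IsWeakFCSequence J xs) : ∃ ys, F.IsMaximalWeakFCSequence J (xs ++ ys) := by
  obtain ⟨h₁, K, hK⟩ := hF
  have hK' : F.IsReduction (K ⊔ Ideal.ofList xs) :=
    IsReduction.sup_of_le hK (Ideal.span_le.2 h.1)
  obtain ⟨ys, hys, -⟩ := h.exists_isMaximalWeakFCSequence h₁ hK'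
    (fun x hx => Ideal.mem_sup_right (Ideal.subset_span hx))
  exact ⟨ys, hys⟩

end IdealFiltration

theorem proposition2p4 {A : Type u} [CommRing A] [IsNoetherianRing A] [IsLocalRing A]
    [Infinite (IsLocalRing.ResidueField A)]
    (J : Ideal A) (hJ : J.radical = IsLocalRing.maximalIdeal A)
    (F : IdealFiltration A) (hF : F.IsGood) :
    ∃ ℓ : ℕ, F.analyticSpread = ℓ ∧
      -- (i)
      (0 < ℓ → ∃ e : ℝ,
        F.HasFiberMultiplicity J e ∧
        HasMultiplicity (F.fiberPos J) e ∧
        (∀ n : ℕ, F.fiberLength J n ≠ ⊤) ∧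
        Tendsto (fun n : ℕ =>
          (((ℓ - 1)! : ℕ) : ℝ) * ((F.fiberLength J n).toNat : ℝ) / (n : ℝ) ^ (ℓ - 1))
          atTop (𝓝 e)) ∧
      -- (ii)
      (1 < ℓ → ∀ x : A, F.IsWeakFCElement J x → ∃ e : ℝ,
        (F.quotient (Ideal.span {x})).HasFiberMultiplicity
          (J.map (Ideal.Quotient.mk (Ideal.span {x}))) e ∧
        F.HasFiberMultiplicity J e) ∧
      -- (iii)
      ((∃ xs : List A, F.IsMaximalWeakFCSequence J xs) ∧
        ∀ xs : List A, F.IsMaximalWeakFCSequence J xs → xs.length = ℓ) ∧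
      -- (iv)
      (∀ xs : List A, F.IsWeakFCSequence J xs → xs.length = ℓ →
        F.IsMinimalReduction (Ideal.ofList xs)) ∧
      -- (v)
      (∀ K : Ideal A, F.IsMinimalReduction K →
        ∃ xs : List A, F.IsMaximalWeakFCSequence J xs ∧ Ideal.ofList xs = K) := by
  obtain ⟨zs, hzs⟩ := (IdealFiltration.isWeakFCSequence_nil (F := F) (J := J)).exists_append hF
  rw [List.nil_append] at hzs
  have hlen : ∀ xs : List A, F.IsMaximalWeakFCSequence J xs → xs.length = zs.length := by
    intro xs hxs
    have h := (hxs.analyticSpread hJ).symm.trans (hzs.analyticSpread hJ)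
    exact_mod_cast h
  refine ⟨zs.length, hzs.analyticSpread hJ, fun hpos => ?_, fun hone x hx => ?_,
    ⟨⟨zs, hzs⟩, hlen⟩, fun xs hxs hℓ => ?_, fun K hK => ?_⟩
  · obtain ⟨e, he⟩ := hzs.fcChain.exists_tendsto_fiberLength hJ hpos
    obtain ⟨h₁, h₂⟩ := hzs.fcChain.hasMultiplicity hJ (Nat.sub_add_cancel hpos).symm he
    exact ⟨e, h₁, h₂, IdealFiltration.fiberLength_ne_top F hJ, he⟩
  · obtain ⟨ys, hys⟩ := hx.isWeakFCSequence_singleton.exists_append hF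
    rw [List.singleton_append] at hys
    have hℓ := hlen _ hys
    have hchain := hys.fcChain
    -- a chain of length `ℓ` starting with `x` gives one of length `ℓ - 1` for `F / (x)`
    cases hchain with
    | cons _ hchain' =>
      have := hx.1.1.nontrivial_quotient hx.span_le
      have hloc : IsLocalRing (A ⧸ Ideal.span {x}) :=
        IsLocalRing.of_surjective' (Ideal.Quotient.mk _) Ideal.Quotient.mk_surjective
      have hJ' := IsLocalRing.radical_map_of_surjective
        (f := Ideal.Quotient.mk (Ideal.span {x})) Ideal.Quotient.mk_surjective hJ
      obtain ⟨d, hd⟩ : ∃ d, ys.length = d + 1 :=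
        Nat.exists_eq_succ_of_ne_zero (by rw [List.length_cons] at hℓ; omega)
      obtain ⟨e, he⟩ := hchain'.exists_tendsto_fiberLength hJ' (by rw [List.length_map]; omega)
      rw [List.length_map, hd, Nat.add_sub_cancel] at he
      exact ⟨e, (hchain'.hasMultiplicity hJ' (by rw [List.length_map, hd]) he).1,
        (hys.fcChain.hasMultiplicity hJ (by rw [List.length_cons, hd])
          (hx.tendsto_fiberLength hJ he)).1⟩
  · -- no proper extension of a sequence of length `ℓ` is a weak-(FC)-sequence
    obtain ⟨ys, hys⟩ := hxs.exists_append hF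
    have h := hlen _ hys
    rw [List.length_append, hℓ] at h
    obtain rfl : ys = [] := List.length_eq_zero_iff.1 (by omega)
    rw [List.append_nil] at hys
    exact hys.isReduction.isMinimalReduction (hys.analyticSpread hJ)
  · obtain ⟨xs, hxs, hxsK⟩ := (IdealFiltration.isWeakFCSequence_nil (F := F)
      (J := J)).exists_isMaximalWeakFCSequence hF.1 hK.1 (fun _ h => absurd h List.not_mem_nil)
    rw [List.nil_append] at hxs hxsK
    exact ⟨xs, hxs, hK.2 _ hxs.isReduction (Ideal.span_le.2 hxsK)⟩
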